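/- **Networks.** A 3D ReLU network $\mathbb R^{d}\to\mathbb R$ with $K$ hidden layers is given as follows. The neurons of the $k$-th hidden layer are arranged on floors $1,\dots,H_k$ ($H_k\ge 1$), with $w_{kh}\ge 1$ neurons on floor $h$. The output of a neuron of layer $k$ is $\max\{0,\,g+s\}$, where $g$ is an affine function (with arbitrary real weights and bias) of the outputs of all neurons of layer $k-1$ (of the input $\boldsymbol x$ if $k=1$), and $s$ is a linear combination, with arbitrary real coefficients, of the outputs of the neurons on strictly lower floors of the same layer $k$. The network output is an affine function of the outputs of the last hidden layer. Its width is $\max_{k,h}w_{kh}$ and its height is $\max_kH_k$. Let $\mathcal N_{W,K,H}$ be the set of functions $\mathbb R^d\to\mathbb R$ computed by such networks with width $W$, $K$ hidden layers and height $H$. **Theorem.** Let $d\ge1$, let $\boldsymbol\tau=(\tau_1,\dots,\tau_d)$ with all $\tau_j>0$, and let $S_{\boldsymbol\tau}=\{\boldsymbol z=\boldsymbol x+\mathrm i\boldsymbol y\in\mathbb C^d: |y_j|<\tau_j,\ j=1,\dots,d\}$. For every $\boldsymbol\beta$ with $0\le\beta_j<\tau_j$ for all $j$ let a constant $A_{\boldsymbol\beta}>0$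 be given. Fix $\boldsymbol\beta$ with $0<\beta_j<\tau_j$ for all $j$, and put $$B=\frac1{\sqrt2}\Big(\prod_{j=1}^d\beta_j\Big)^{1/d}.$$ Then there is a constant $C>0$, depending only on $d$, $\boldsymbol\tau$, $\boldsymbol\beta$ and the constants $A_{\boldsymbol\beta'}$, such that the following holds. Let $f:\mathbb R^d\to\mathbb R$ have a holomorphic continuation to $S_{\boldsymbol\tau}$, also denoted by $f$, such that for every $\boldsymbol\beta'$ with $0\le\beta_j'<\tau_j$ for all $j$, $$|f(\boldsymbol z)|\le A_{\boldsymbol\beta'}\exp\Big(\sum_{j=1}^d\Big(\frac{x_j^2}{4}-\frac1{\sqrt2}|x_j|\sqrt{\beta_j'^2-\frac{y_j^2}{2}}\Big)\Big)$$ for all $\boldsymbol z=\boldsymbol x+\mathrm i\boldsymbol y\in S_{\boldsymbol\tau}$ with $y_j^2\le2\beta_j'^2$ for all $j$. Then for every integer $N\ge1$ there is a function $\Phi\in\mathcal N_{W,\,N+d-1,\,H}$ with $$W=\max\{8Nd,\,N^d(4+d)\},$$ $$H=\Big\lceil\frac d2N\log_2\Big(1+6\sqrt{2N\ln(6N)+4B\sqrt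 N}\Big)+\log_2\Big(\frac54N\Big)+\frac{B\log_2 e}{2}\sqrt N\Big\rceil,$$ such that $$\|f-\Phi\|_{L^2(\mathbb R^d,\gamma_d)}\le C\,e^{-B\sqrt N},$$ where $\gamma_d$ is the standard Gaussian measure on $\mathbb R^d$. -/

import Mathlib

open MeasureTheory ProbabilityTheory

noncomputable section

namespace ReLU3D

/-- One hidden layer of a 3D ReLU network, reading real inputs indexed by `ι`. The layer consists of
`floors` floors, the floor `h` holding `size h` neurons. Besides the weights `a` from the previous
layer and the biases `b`, there are intra-layer links: `G h₁ h₂ n₁ n₂` is the coefficient of the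
link from neuron `n₁` of floor `h₁` to neuron `n₂` of floor `h₂`. Only links from a lower to a
strictly higher floor are used (see `Layer.out`). -/
structure Layer (ι : Type) where
  floors : ℕ
  floors_pos : 0 < floors
  size : Fin floors → ℕ
  size_pos : ∀ h, 0 < size h
  a : (h : Fin floors) → Fin (size h) → ι → ℝ
  b : (h : Fin floors) → Fin (size h) → ℝ
  G : (h₁ h₂ : Fin floors) → Fin (size h₁) → Fin (size h₂) → ℝ

/-- The neurons of a layer, over all its floors. -/
abbrev Layer.Neuron {ι : Type} (L : Layer ι) : Type := Σ h : Fin L.floors, Fin (L.size h)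

/-- The output of neuron `n` of floor `h` on the input `x`: the ReLU of the affine pre-activation
plus the weighted outputs of the neurons on the strictly lower floors of the same layer. -/
def Layer.out {ι : Type} [Fintype ι] (L : Layer ι) (x : ι → ℝ) (h : Fin L.floors)
    (n : Fin (L.size h)) : ℝ :=
  max ((∑ i, L.a h n i * x i) + L.b h n
    + ∑ q : {q : Fin L.floors // q < h}, ∑ m : Fin (L.size q.1), L.G q.1 h m n * L.out x q.1 m) 0
termination_by h
decreasing_by exact q.2

/-- The largest number of neurons on a floor of the layer. -/
def Layer.width {ι : Type} (L : Layer ι) : ℕ := Finset.univ.sup L.size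

/-- A 3D ReLU network with inputs indexed by `ι` and one real output: hidden layers, each reading
the outputs of all neurons of the preceding one, followed by an affine output. -/
inductive Net : Type → Type 1
  | output {ι : Type} (c : ι → ℝ) (c₀ : ℝ) : Net ι
  | hidden {ι : Type} (L : Layer ι) (rest : Net L.Neuron) : Net ι

/-- The function computed by a network. -/
def Net.eval : {ι : Type} → [Fintype ι] → Net ι → (ι → ℝ) → ℝ
  | _, _, .output c c₀, x => (∑ i, c i * x i) + c₀
  | _, _, .hidden L rest, x => rest.eval (fun p => L.out x p.1 p.2)

/-- The number of hidden layers. -/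
def Net.hiddenLayers : {ι : Type} → Net ι → ℕ
  | _, .output _ _ => 0
  | _, .hidden _ rest => rest.hiddenLayers + 1

/-- The width: the largest number of neurons on a floor of a hidden layer. -/
def Net.width : {ι : Type} → Net ι → ℕ
  | _, .output _ _ => 0
  | _, .hidden L rest => max L.width rest.width

/-- The height: the largest number of floors of a hidden layer. -/
def Net.height : {ι : Type} → Net ι → ℕ
  | _, .output _ _ => 0
  | _, .hidden L rest => max L.floors rest.height

/-- The functions `ℝ^d → ℝ` computed by 3D ReLU networks of width `W` and height `H` with `K` hidden
layers. -/
def networks (d W K H : ℕ) : Set ((Fin d → ℝ) → ℝ) :=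
  {Φ | ∃ net : Net (Fin d), net.width = W ∧ net.hiddenLayers = K ∧ net.height = H ∧ net.eval = Φ}

end ReLU3D

/-- The complex open strip `{z ∈ ℂ^d : |Im z_j| < τ_j for all j}`. -/
def complexStrip {d : ℕ} (τ : Fin d → ℝ) : Set (Fin d → ℂ) := {z | ∀ j, |(z j).im| < τ j}

/-- `F` is a holomorphic continuation of `f : ℝ^d → ℝ` to the complex strip. -/
def IsHolomorphicContinuation {d : ℕ} (τ : Fin d → ℝ) (f : (Fin d → ℝ) → ℝ)
    (F : (Fin d → ℂ) → ℂ) : Prop :=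
  DifferentiableOn ℂ F (complexStrip τ) ∧ ∀ x : Fin d → ℝ, F (fun j => (x j : ℂ)) = (f x : ℂ)

/-- The growth bound with parameter `β` and constant `A` on the strip, required at the points where
the square roots are those of nonnegative numbers. -/
def GrowthBound {d : ℕ} (τ β : Fin d → ℝ) (A : ℝ) (F : (Fin d → ℂ) → ℂ) : Prop :=
  ∀ z ∈ complexStrip τ, (∀ j, 0 ≤ β j ^ 2 - (z j).im ^ 2 / 2) →
    ‖F z‖ ≤ A * Real.exp (∑ j, ((z j).re ^ 2 / 4
      - 1 / √2 * |(z j).re| * √(β j ^ 2 - (z j).im ^ 2 / 2)))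

/-- The standard Gaussian measure on `ℝ^d`. -/
def stdGaussianPi (d : ℕ) : Measure (Fin d → ℝ) := Measure.pi fun _ => gaussianReal 0 1

/-- The exponent `(∏ β_j)^{1/d} / √2` in the approximation rate. -/
def rateExponent {d : ℕ} (β : Fin d → ℝ) : ℝ := (∏ j, β j) ^ (1 / (d : ℝ)) / √2

/-- The height of the approximating network. -/
def netHeight (d N : ℕ) (B : ℝ) : ℕ :=
  ⌈(d : ℝ) / 2 * N * Real.logb 2 (1 + 6 * √(2 * N * Real.log (6 * N) + 4 * B * √N))
    + Real.logb 2 (5 / 4 * N) + B * Real.logb 2 (Real.exp 1) / 2 * √N⌉₊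

end

/-!
The rate `exp (-B √N)` needs no Hermite expansion. Since the constant `C` may absorb finitely many
`N`, only the growth of the sizes matters, and the height `H` grows like `N log N`, faster than the
linear height that suffices for the following construction.

On a cube of side proportional to `√N` the function is approximated cell by cell, on about `√N`
cells per coordinate whose size is comparable to the width of the strip, by a polynomial of degree
less than `n ≈ √N` in each variable (`exists_cell_polynomial`). The polynomial interpolates the
holomorphic continuation at roots of unity, one variable at a time (`exists_interpolation`,
`exists_polynomial_approx`); its coefficients are bounded by the supremum of the continuation near
the cell and its error is that supremum times `2 ^ (-n)` up to powers of `n`. The supremum exceeds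
`exp (∑ x_j² / 4)` on the cell by a factor `exp (O(√N))` only, so a degree that is a large multiple
of `√N` makes the weighted error smaller than `exp (-B √N)`. Outside the cube the decay in the
growth bound on the real points does the same.

The cells are glued by hat functions, so the approximant is a linear combination of `O(N ^ d)`
products of `O(√N)` piecewise linear factors with values in `[-1, 1]`. Each product is computed by a
serial program of `O(N)` ReLU neurons, one per floor, through approximate multiplication with the
saw-tooth approximation of the square (`mulApprox`, `approxComputable_prod`). The approximate
product vanishes exactly where one of the factors does; hence errors stay local, and the large
coefficients of distant cells do no harm where the Gaussian weight is not small. As the width is at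
least `N ^ d`, all the programs fit into the first hidden layer in a bounded number of consecutive
batches of total height `O(N)` (`sum_mem_networks`), and the other layers only pass a scalar on.
-/

/-! ### Serial ReLU programs -/

namespace ReLU3D

/-- The space of affine functions `ℝ^d → ℝ`. -/
def affineFunctions (d : ℕ) : Submodule ℝ ((Fin d → ℝ) → ℝ) where
  carrier := {g | ∃ (a : Fin d → ℝ) (b : ℝ), g = fun x => ∑ i, a i * x i + b}
  zero_mem' := ⟨0, 0, by ext; simp⟩
  add_mem' := by
    rintro _ _ ⟨a, b, rfl⟩ ⟨a', b', rfl⟩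
    refine ⟨a + a', b + b', ?_⟩
    ext x
    simp only [Pi.add_apply, add_mul, Finset.sum_add_distrib]
    ring
  smul_mem' := by
    rintro c _ ⟨a, b, rfl⟩
    refine ⟨c • a, c * b, ?_⟩
    ext x
    simp only [Pi.smul_apply, smul_eq_mul, mul_add, Finset.mul_sum, mul_assoc]

/-- The pointwise positive part of a function. -/
noncomputable def relu {X : Type*} (g : X → ℝ) : X → ℝ := fun x => max (g x) 0

/-- The pre-activations that neuron `n` of the serial program `u` may use: combinations of affine
functions of the input and of the outputs of the neurons before `n`. -/
def available {d : ℕ} (u : ℕ → (Fin d → ℝ) → ℝ) (n : ℕ) : Submodule ℝ ((Fin d → ℝ) → ℝ) :=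
  affineFunctions d ⊔ Submodule.span ℝ (u '' Set.Iio n)

/-- The functions `u 0, …, u (n - 1)` are the neurons of a serial program, a skip-connected ReLU
network with one neuron on each floor. -/
def IsProgram {d : ℕ} (u : ℕ → (Fin d → ℝ) → ℝ) (n : ℕ) : Prop :=
  ∀ k < n, ∃ g ∈ available u k, u k = relu g

/-- `V` is the space of functions available after some serial program with `n` neurons. -/
def Computes {d : ℕ} (n : ℕ) (V : Submodule ℝ ((Fin d → ℝ) → ℝ)) : Prop :=
  ∃ u, IsProgram u n ∧ V = available u n

section
variable {d : ℕ} {u v : ℕ → (Fin d → ℝ) → ℝ} {n m : ℕ} {V : Submodule ℝ ((Fin d → ℝ) → ℝ)}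
  {g : (Fin d → ℝ) → ℝ}

lemma available_congr (h : ∀ k < n, u k = v k) : available u n = available v n := by
  have e : u '' Set.Iio n = v '' Set.Iio n := Set.image_congr fun k hk => h k hk
  rw [available, available, e]

lemma available_mono (h : n ≤ m) : available u n ≤ available u m :=
  sup_le_sup_left (Submodule.span_mono (Set.image_mono (Set.Iio_subset_Iio h))) _

lemma exists_isProgram_succ (hu : IsProgram u n) (hg : g ∈ available u n) :
    ∃ v, IsProgram v (n + 1) ∧ (∀ k < n, v k = u k) ∧ v n = relu g := by
  have hv : ∀ k < n, Function.update u n (relu g) k = u k := fun k hk =>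
    Function.update_of_ne hk.ne _ _
  refine ⟨Function.update u n (relu g), ?_, hv, by simp⟩
  intro k hk
  rcases Nat.lt_succ_iff_lt_or_eq.1 hk with h | rfl
  · obtain ⟨g', hg', e⟩ := hu k h
    refine ⟨g', ?_, by rw [hv k h, e]⟩
    rwa [available_congr fun l hl => hv l (hl.trans h)]
  · refine ⟨g, ?_, by simp⟩
    rwa [available_congr hv]

lemma computes_zero : Computes 0 (affineFunctions d) :=
  ⟨fun _ => 0, fun k hk => absurd hk (by simp), by simp [available]⟩

lemma Computes.affine_le (h : Computes n V) : affineFunctions d ≤ V := by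
  obtain ⟨u, -, rfl⟩ := h
  exact le_sup_left

lemma Computes.relu (h : Computes n V) (hg : g ∈ V) :
    ∃ V', Computes (n + 1) V' ∧ V ≤ V' ∧ relu g ∈ V' := by
  obtain ⟨u, hu, rfl⟩ := h
  obtain ⟨v, hv, hvu, hvn⟩ := exists_isProgram_succ hu hg
  refine ⟨available v (n + 1), ⟨v, hv, rfl⟩, ?_, ?_⟩
  · rw [← available_congr hvu]
    exact available_mono n.le_succ
  · rw [← hvn]
    exact Submodule.mem_sup_right (Submodule.subset_span ⟨n, n.lt_succ_self, rfl⟩)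

lemma Computes.mono (h : Computes n V) (hnm : n ≤ m) : ∃ V', Computes m V' ∧ V ≤ V' := by
  induction m, hnm using Nat.le_induction with
  | base => exact ⟨V, h, le_rfl⟩
  | succ m _ ih =>
    obtain ⟨V', h', hV⟩ := ih
    obtain ⟨V'', h'', hV', -⟩ := h'.relu (g := 0) (zero_mem _)
    exact ⟨V'', h'', hV.trans hV'⟩

lemma Computes.const_mem (h : Computes n V) (c : ℝ) : (fun _ => c) ∈ V :=
  h.affine_le ⟨0, c, by simp⟩

lemma Computes.coord_mem (h : Computes n V) (j : Fin d) : (fun x => x j) ∈ V :=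
  h.affine_le ⟨Pi.single j 1, 0, by ext; simp [Pi.single_apply]⟩

/-- With two more neurons every available function becomes a linear combination of neuron outputs
alone; this matters because the layers after the first do not see the input. -/
lemma Computes.exists_program (h : Computes n V) (hg : g ∈ V) :
    ∃ u : ℕ → (Fin d → ℝ) → ℝ, IsProgram u (n + 2) ∧ ∀ x, g x = u n x - u (n + 1) x := by
  obtain ⟨u, hu, rfl⟩ := h
  obtain ⟨v, hv, hvu, hvn⟩ := exists_isProgram_succ hu hg
  have hg' : -g ∈ available v (n + 1) := by
    refine available_mono n.le_succ ?_
    rw [available_congr hvu]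
    exact neg_mem hg
  obtain ⟨w, hw, hwv, hwn⟩ := exists_isProgram_succ hv hg'
  refine ⟨w, hw, fun x => ?_⟩
  rw [hwn, hwv n n.lt_succ_self, hvn]
  simp only [ReLU3D.relu, Pi.neg_apply]
  rcases le_total (g x) 0 with h | h <;> simp [h]

end

/-! ### Running many programs inside one layer -/

/-- A `W`-wide, `H`-high array of functions in which every entry is the ReLU of an affine function
plus a linear combination of the entries on lower floors is the list of neuron outputs of a layer. -/
lemma exists_layer {d W H : ℕ} (hW : 0 < W) (hH : 0 < H) (U : ℕ → Fin W → (Fin d → ℝ) → ℝ)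
    (hU : ∀ h < H, ∀ m, ∃ g ∈ affineFunctions d ⊔
      Submodule.span ℝ {f | ∃ q < h, ∃ m', f = U q m'}, U h m = relu g) :
    ∃ L : Layer (Fin d), ∃ hf : L.floors = H, ∃ hs : ∀ h, L.size h = W,
      ∀ x h n, L.out x h n = U (Fin.cast hf h) (Fin.cast (hs h) n) x := by
  have key : ∀ (h : Fin H) (m : Fin W), ∃ (a : Fin d → ℝ) (b : ℝ) (G : Fin H → Fin W → ℝ),
      ∀ x, U h m x = max ((∑ i, a i * x i) + b
        + ∑ q : {q : Fin H // q < h}, ∑ m', G q.1 m' * U q.1 m' x) 0 := by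
    intro h m
    obtain ⟨g, hg, e⟩ := hU h h.2 m
    obtain ⟨g₁, ⟨a, b, rfl⟩, g₂, hg₂, rfl⟩ := Submodule.mem_sup.1 hg
    have hset : {f | ∃ q < (h : ℕ), ∃ m', f = U q m'} =
        Set.range (fun p : {q : Fin H // q < h} × Fin W => U p.1.1 p.2) := by
      ext f
      constructor
      · rintro ⟨q, hq, m', rfl⟩
        exact ⟨(⟨⟨q, hq.trans h.2⟩, hq⟩, m'), rfl⟩
      · rintro ⟨⟨q, m'⟩, rfl⟩
        exact ⟨q.1, q.2, m', rfl⟩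
    rw [hset] at hg₂
    obtain ⟨c, rfl⟩ := (Submodule.mem_span_range_iff_exists_fun ℝ).1 hg₂
    refine ⟨a, b, fun q m' => if hq : q < h then c (⟨q, hq⟩, m') else 0, fun x => ?_⟩
    rw [e]
    simp only [relu, Pi.add_apply, Finset.sum_apply, Pi.smul_apply, smul_eq_mul]
    rw [Fintype.sum_prod_type]
    congr 2
    refine Finset.sum_congr rfl fun q _ => Finset.sum_congr rfl fun m' _ => ?_
    rw [dif_pos q.2]
  choose a b G hG using key
  refine ⟨⟨H, hH, fun _ => W, fun _ => hW, a, b, fun q h m' m => G h m q m'⟩, rfl, fun _ => rfl, ?_⟩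
  intro x h
  induction h using WellFoundedLT.induction with
  | ind h ih =>
    intro n
    rw [Layer.out]
    simp only [Fin.cast_eq_self]
    rw [hG]
    congr 2
    refine Finset.sum_congr rfl fun q _ => Finset.sum_congr rfl fun m' _ => ?_
    rw [ih q.1 q.2]
    rfl

/-- A layer with one floor holding two neurons, the positive and the negative part of the affine
function `c · x + c₀`. -/
def splitLayer {ι : Type} (c : ι → ℝ) (c₀ : ℝ) : Layer ι where
  floors := 1
  floors_pos := one_pos
  size _ := 2
  size_pos _ := two_pos
  a _ n i := if n.val = 0 then c i else -c i
  b _ n := if n.val = 0 then c₀ else -c₀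
  G _ _ _ _ := 0

lemma splitLayer_out {ι : Type} [Fintype ι] (c : ι → ℝ) (c₀ : ℝ) (x : ι → ℝ)
    (h : Fin (splitLayer c c₀).floors) (n : Fin ((splitLayer c c₀).size h)) :
    (splitLayer c c₀).out x h n =
      max (if n.val = 0 then ∑ i, c i * x i + c₀ else -(∑ i, c i * x i + c₀)) 0 := by
  rw [Layer.out]
  have h0 : (∑ q : {q : Fin (splitLayer c c₀).floors // q < h},
      ∑ m : Fin ((splitLayer c c₀).size q.1),
        (splitLayer c c₀).G q.1 h m n * (splitLayer c c₀).out x q.1 m) = 0 :=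
    Finset.sum_eq_zero fun q _ => Finset.sum_eq_zero fun m _ => zero_mul _
  rw [h0, add_zero]
  by_cases hn : n.val = 0
  · simp [splitLayer, hn]
  · simp [splitLayer, hn, Finset.sum_neg_distrib, add_comm]

/-- `K` hidden layers that pass the scalar `c · x + c₀` on to the output. -/
def passNet : (K : ℕ) → {ι : Type} → (ι → ℝ) → ℝ → Net ι
  | 0, _, c, c₀ => .output c c₀
  | K + 1, _, c, c₀ =>
    .hidden (splitLayer c c₀) (passNet K (fun p => if p.2.val = 0 then 1 else -1) 0)

lemma passNet_spec (K : ℕ) {ι : Type} [Fintype ι] (c : ι → ℝ) (c₀ : ℝ) :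
    (∀ x, (passNet K c c₀).eval x = ∑ i, c i * x i + c₀) ∧ (passNet K c c₀).hiddenLayers = K ∧
      (passNet K c c₀).width ≤ 2 ∧ (passNet K c c₀).height ≤ 1 := by
  induction K generalizing ι c₀ with
  | zero => simp [passNet, Net.eval, Net.hiddenLayers, Net.width, Net.height]
  | succ K ih =>
    obtain ⟨h₁, h₂, h₃, h₄⟩ := ih (ι := (splitLayer c c₀).Neuron)
      (fun p => if p.2.val = 0 then 1 else -1) 0
    refine ⟨fun x => ?_, by simp [passNet, Net.hiddenLayers, h₂], ?_, ?_⟩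
    · rw [passNet, Net.eval, h₁, Fintype.sum_sigma]
      have h0 : ∀ (h : Fin 1) (n : Fin 2), (splitLayer c c₀).out x h n =
          max (if n.val = 0 then ∑ i, c i * x i + c₀ else -(∑ i, c i * x i + c₀)) 0 :=
        splitLayer_out c c₀ x
      change ∑ h : Fin 1, ∑ n : Fin 2, (if n.val = 0 then (1 : ℝ) else -1) *
        (splitLayer c c₀).out x h n + 0 = _
      simp only [h0, Finset.univ_unique, Finset.sum_singleton, Fin.sum_univ_two, Fin.val_zero,
        Fin.val_one]
      rcases le_total (∑ i, c i * x i + c₀) 0 with h | h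
      · simp only [if_true, one_ne_zero, if_false, max_eq_right h,
          max_eq_left (neg_nonneg.2 h)]
        ring
      · simp only [if_true, one_ne_zero, if_false, max_eq_left h,
          max_eq_right (neg_nonpos.2 h)]
        ring
    · rw [passNet, Net.width]
      refine max_le (Finset.sup_le fun _ _ => le_rfl) h₃
    · rw [passNet, Net.height]
      exact max_le le_rfl h₄

/-- Linear combinations of programs of length `D` fit into the first layer of a network of width `W`
and height `H`, the programs being run in `B` consecutive batches of `W` parallel ones. -/
lemma sum_mem_networks {d W K H B D : ℕ} (hW : 2 ≤ W) (hK : 1 ≤ K) (hH : 1 ≤ H)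
    (hBD : B * D ≤ H) {ι : Type*} [Fintype ι] (hι : Fintype.card ι ≤ B * W)
    (u : ι → ℕ → (Fin d → ℝ) → ℝ) (hu : ∀ i, IsProgram (u i) D) (p q : ℕ) (hp : p < D) (hq : q < D)
    (c : ι → ℝ) : (fun x => ∑ i, c i * (u i p x - u i q x)) ∈ networks d W K H := by
  classical
  have hW0 : 0 < W := by omega
  have hD0 : 0 < D := by omega
  set e : ι ≃ Fin (Fintype.card ι) := Fintype.equivFin ι
  -- program `r` occupies lane `r % W` of batch `r / W`
  let U : ℕ → Fin W → (Fin d → ℝ) → ℝ := fun h m =>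
    if hr : h / D * W + m < Fintype.card ι then u (e.symm ⟨h / D * W + m, hr⟩) (h % D) else 0
  have hU : ∀ h < H, ∀ m, ∃ g ∈ affineFunctions d ⊔
      Submodule.span ℝ {f | ∃ q < h, ∃ m', f = U q m'}, U h m = relu g := by
    intro h _ m
    by_cases hr : h / D * W + m < Fintype.card ι
    · obtain ⟨g, hg, eq⟩ := hu (e.symm ⟨h / D * W + m, hr⟩) (h % D) (Nat.mod_lt _ hD0)
      refine ⟨g, ?_, by simp only [U, dif_pos hr, eq]⟩
      have hle : available (u (e.symm ⟨h / D * W + m, hr⟩)) (h % D) ≤ affineFunctions d ⊔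
          Submodule.span ℝ {f | ∃ q < h, ∃ m', f = U q m'} := by
        refine sup_le_sup_left (Submodule.span_mono ?_) _
        rintro _ ⟨k, hk, rfl⟩
        have hk' : k < h % D := hk
        have hkD : k < D := hk'.trans (Nat.mod_lt _ hD0)
        have h1 : (h / D * D + k) / D = h / D := by
          rw [mul_comm, Nat.mul_add_div hD0, Nat.div_eq_of_lt hkD, add_zero]
        have h2 : (h / D * D + k) % D = k := by
          rw [mul_comm, Nat.mul_add_mod, Nat.mod_eq_of_lt hkD]
        refine ⟨h / D * D + k, ?_, m, ?_⟩
        · have := Nat.div_add_mod h D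
          rw [mul_comm] at this
          omega
        · simp only [U, h1, h2, dif_pos hr]
      exact hle hg
    · refine ⟨0, zero_mem _, ?_⟩
      simp only [U, dif_neg hr]
      ext x
      simp [relu]
  obtain ⟨L, hf, hs, hL⟩ := exists_layer hW0 hH U hU
  have hlt : ∀ (i : ι) (k : ℕ), k < D → (e i : ℕ) / W * D + k < H := by
    intro i k hk
    have : (e i : ℕ) / W < B := Nat.div_lt_of_lt_mul (by
      rw [mul_comm]; exact (e i).2.trans_le hι)
    calc (e i : ℕ) / W * D + k < (e i : ℕ) / W * D + D := by omega
      _ = ((e i : ℕ) / W + 1) * D := by ring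
      _ ≤ B * D := Nat.mul_le_mul_right _ this
      _ ≤ H := hBD
  let pos : ι → (k : ℕ) → k < D → L.Neuron := fun i k hk =>
    ⟨Fin.cast hf.symm ⟨(e i : ℕ) / W * D + k, hlt i k hk⟩,
      Fin.cast (hs _).symm ⟨(e i : ℕ) % W, Nat.mod_lt _ hW0⟩⟩
  have hpos : ∀ i k hk x, L.out x (pos i k hk).1 (pos i k hk).2 = u i k x := by
    intro i k hk x
    rw [hL]
    have h1 : ((e i : ℕ) / W * D + k) / D = (e i : ℕ) / W := by
      rw [mul_comm, Nat.mul_add_div hD0, Nat.div_eq_of_lt hk, add_zero]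
    have h2 : ((e i : ℕ) / W * D + k) % D = k := by
      rw [mul_comm, Nat.mul_add_mod, Nat.mod_eq_of_lt hk]
    have h3 : (e i : ℕ) / W * W + (e i : ℕ) % W = e i := by
      rw [mul_comm]; exact Nat.div_add_mod _ _
    simp [pos, U, h1, h2, h3]
  have hcoef : ∃ c' : L.Neuron → ℝ, ∀ y : L.Neuron → ℝ,
      ∑ t, c' t * y t = ∑ i, c i * (y (pos i p hp) - y (pos i q hq)) := by
    refine ⟨fun t => ∑ i, c i * ((if pos i p hp = t then 1 else 0) -
      (if pos i q hq = t then 1 else 0)), fun y => ?_⟩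
    simp only [Finset.sum_mul]
    rw [Finset.sum_comm]
    refine Finset.sum_congr rfl fun i _ => ?_
    simp only [mul_assoc, ← Finset.mul_sum, sub_mul, Finset.sum_sub_distrib, ite_mul, one_mul,
      zero_mul, Finset.sum_ite_eq, Finset.mem_univ, if_true]
  obtain ⟨c', hc'⟩ := hcoef
  obtain ⟨h₁, h₂, h₃, h₄⟩ := passNet_spec (K - 1) c' 0
  refine ⟨.hidden L (passNet (K - 1) c' 0), ?_, ?_, ?_, ?_⟩
  · rw [Net.width]
    have : L.width = W := by
      have : Nonempty (Fin L.floors) := ⟨⟨0, L.floors_pos⟩⟩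
      rw [Layer.width, Finset.sup_congr rfl fun h _ => hs h,
        Finset.sup_const Finset.univ_nonempty]
    omega
  · rw [Net.hiddenLayers]; omega
  · rw [Net.height]; omega
  · ext x
    rw [Net.eval, h₁, hc', add_zero]
    simp only [hpos]

end ReLU3D

/-! ### Approximate multiplication -/

namespace ReLU3D

/-- The tent map, `2t` for `t ≤ 1/2` and `2 - 2t` for `t ≥ 1/2`. -/
noncomputable def tent (t : ℝ) : ℝ := 2 * t - 4 * max (t - 1 / 2) 0

/-- The partial sums of Takagi-type series `t - t² = ∑ k ≥ 1, tent^[k] t / 4 ^ k` on `[0, 1]`. -/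
noncomputable def bumpApprox : ℕ → ℝ → ℝ
  | 0, _ => 0
  | m + 1, t => (tent t + bumpApprox m (tent t)) / 4

/-- An approximation of `a * b` for `|a|, |b| ≤ 1`, from `ab = ((a + b) / 2)² - ((a - b) / 2)²` and
the approximation `t - bumpApprox m t` of the square. -/
noncomputable def mulApprox (m : ℕ) (a b : ℝ) : ℝ :=
  (|a + b| / 2 - bumpApprox m (|a + b| / 2)) - (|a - b| / 2 - bumpApprox m (|a - b| / 2))

lemma tent_mem {t : ℝ} (h0 : 0 ≤ t) (h1 : t ≤ 1) : 0 ≤ tent t ∧ tent t ≤ 1 := by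
  unfold tent
  rcases le_total (t - 1 / 2) 0 with h | h
  · rw [max_eq_right h]; constructor <;> linarith
  · rw [max_eq_left h]; constructor <;> linarith

lemma bump_eq_tent (t : ℝ) : t - t ^ 2 = (tent t + (tent t - tent t ^ 2)) / 4 := by
  unfold tent
  rcases le_total (t - 1 / 2) 0 with h | h
  · rw [max_eq_right h]; ring
  · rw [max_eq_left h]; ring

lemma bumpApprox_bounds (m : ℕ) {t : ℝ} (h0 : 0 ≤ t) (h1 : t ≤ 1) :
    0 ≤ bumpApprox m t ∧ bumpApprox m t ≤ t - t ^ 2 ∧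
      t - t ^ 2 ≤ bumpApprox m t + (1 / 4) ^ m := by
  induction m generalizing t with
  | zero => simp only [bumpApprox]; refine ⟨le_rfl, ?_, ?_⟩ <;> nlinarith
  | succ m ih =>
    obtain ⟨hT0, hT1⟩ := tent_mem h0 h1
    obtain ⟨i1, i2, i3⟩ := ih hT0 hT1
    have h4 := pow_succ (1 / 4 : ℝ) m
    rw [bump_eq_tent t, bumpApprox]
    refine ⟨?_, ?_, ?_⟩ <;> linarith

lemma mulApprox_bounds (m : ℕ) {a b : ℝ} (ha : |a| ≤ 1) (hb : |b| ≤ 1) :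
    |mulApprox m a b| ≤ 1 ∧ |mulApprox m a b - a * b| ≤ (1 / 4) ^ m := by
  have hp : |a + b| / 2 ≤ 1 := by linarith [abs_add_le a b]
  have hm : |a - b| / 2 ≤ 1 := by linarith [abs_sub a b]
  have hp0 : 0 ≤ |a + b| / 2 := by positivity
  have hm0 : 0 ≤ |a - b| / 2 := by positivity
  obtain ⟨p1, p2, p3⟩ := bumpApprox_bounds m hp0 hp
  obtain ⟨q1, q2, q3⟩ := bumpApprox_bounds m hm0 hm
  have e : a * b = (|a + b| / 2) ^ 2 - (|a - b| / 2) ^ 2 := by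
    rw [div_pow, div_pow, sq_abs, sq_abs]; ring
  have s1 := sq_nonneg (|a + b| / 2)
  have s2 := sq_nonneg (|a - b| / 2)
  rw [e, mulApprox]
  constructor <;> rw [abs_le] <;> constructor <;> linarith

lemma mulApprox_zero_left (m : ℕ) (b : ℝ) : mulApprox m 0 b = 0 := by
  simp [mulApprox]

lemma mulApprox_zero_right (m : ℕ) (a : ℝ) : mulApprox m a 0 = 0 := by
  simp [mulApprox]

section
variable {d n : ℕ} {V : Submodule ℝ ((Fin d → ℝ) → ℝ)} {g h : (Fin d → ℝ) → ℝ}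

lemma Computes.bumpApprox (hV : Computes n V) (hg : g ∈ V) (m : ℕ) :
    ∃ V', Computes (n + m) V' ∧ V ≤ V' ∧ (fun x => ReLU3D.bumpApprox m (g x)) ∈ V' := by
  induction m generalizing n V g with
  | zero => exact ⟨V, hV, le_rfl, hV.const_mem 0⟩
  | succ m ih =>
    obtain ⟨V₁, h₁, hV₁, hr⟩ := hV.relu (sub_mem hg (hV.const_mem (1 / 2)))
    have hT : (fun x => tent (g x)) ∈ V₁ :=
      sub_mem (V₁.smul_mem 2 (hV₁ hg)) (V₁.smul_mem 4 hr)
    obtain ⟨V₂, h₂, hV₂, hB⟩ := ih h₁ hT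
    refine ⟨V₂, by rwa [add_assoc, add_comm 1 m] at h₂, hV₁.trans hV₂, ?_⟩
    convert V₂.smul_mem (1 / 4) (add_mem (hV₂ hT) hB) using 1
    ext x
    simp only [ReLU3D.bumpApprox, Pi.smul_apply, Pi.add_apply, smul_eq_mul]
    ring

lemma Computes.abs (hV : Computes n V) (hg : g ∈ V) :
    ∃ V', Computes (n + 1) V' ∧ V ≤ V' ∧ (fun x => |g x|) ∈ V' := by
  obtain ⟨V₁, h₁, hV₁, hr⟩ := hV.relu hg
  refine ⟨V₁, h₁, hV₁, ?_⟩
  convert sub_mem (V₁.smul_mem 2 hr) (hV₁ hg) using 1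
  ext x
  simp only [ReLU3D.relu, Pi.sub_apply, Pi.smul_apply, smul_eq_mul]
  rcases le_total (g x) 0 with h | h
  · rw [abs_of_nonpos h, max_eq_right h]; ring
  · rw [abs_of_nonneg h, max_eq_left h]; ring

lemma Computes.mulApprox (hV : Computes n V) (hg : g ∈ V) (hh : h ∈ V) (m : ℕ) :
    ∃ V', Computes (n + (2 * m + 2)) V' ∧ V ≤ V' ∧
      (fun x => ReLU3D.mulApprox m (g x) (h x)) ∈ V' := by
  obtain ⟨V₁, c₁, l₁, m₁⟩ := hV.abs (add_mem hg hh)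
  obtain ⟨V₂, c₂, l₂, m₂⟩ := c₁.abs (l₁ (sub_mem hg hh))
  have m₁' := V₂.smul_mem (1 / 2) (l₂ m₁)
  have m₂' := V₂.smul_mem (1 / 2) m₂
  obtain ⟨V₃, c₃, l₃, m₃⟩ := c₂.bumpApprox m₁' m
  obtain ⟨V₄, c₄, l₄, m₄⟩ := c₃.bumpApprox (l₃ m₂') m
  refine ⟨V₄, ?_, l₁.trans (l₂.trans (l₃.trans l₄)), ?_⟩
  · convert c₄ using 1; ring
  · convert sub_mem (sub_mem (l₄ (l₃ m₁')) (l₄ m₃)) (sub_mem (l₄ (l₃ m₂')) m₄) using 1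
    ext x
    simp only [ReLU3D.mulApprox, Pi.sub_apply, Pi.add_apply, Pi.smul_apply, smul_eq_mul,
      one_div_mul_eq_div]

end

/-- The function `h` takes values in `[-1, 1]` and costs at most three neurons. -/
def IsFactor {d : ℕ} (h : (Fin d → ℝ) → ℝ) : Prop :=
  (∀ x, |h x| ≤ 1) ∧ ∀ n V, Computes n V → ∃ V', Computes (n + 3) V' ∧ V ≤ V' ∧ h ∈ V'

/-- The function `g`, bounded by `1`, is approximated by a serial program as accurately and as
cheaply as products of `l` factors are. The approximation is exact at the zeros of `g`: this keeps
the error of a localized function local. -/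
def ApproxComputable {d : ℕ} (m l : ℕ) (g : (Fin d → ℝ) → ℝ) : Prop :=
  (∀ x, |g x| ≤ 1) ∧ ∃ V, Computes (l * (2 * m + 5)) V ∧ ∃ w ∈ V, (∀ x, |w x| ≤ 1) ∧
    (∀ x, |w x - g x| ≤ l * (1 / 4) ^ m) ∧ ∀ x, g x = 0 → w x = 0

section
variable {d m l : ℕ} {g h : (Fin d → ℝ) → ℝ}

lemma approxComputable_one (m : ℕ) : ApproxComputable (d := d) m 0 (fun _ => 1) := by
  refine ⟨by simp, affineFunctions d, by simpa using computes_zero, fun _ => 1,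
    computes_zero.const_mem 1, by simp, by simp, by simp⟩

lemma ApproxComputable.mul (hg : ApproxComputable m l g) (hh : IsFactor h) :
    ApproxComputable m (l + 1) (fun x => g x * h x) := by
  obtain ⟨hg1, V, hV, w, hw, hw1, hwg, hw0⟩ := hg
  obtain ⟨hh1, hh2⟩ := hh
  obtain ⟨V₁, c₁, l₁, m₁⟩ := hh2 _ _ hV
  obtain ⟨V₂, c₂, -, m₂⟩ := c₁.mulApprox (l₁ hw) m₁ m
  refine ⟨fun x => ?_, V₂, ?_, _, m₂, fun x => (mulApprox_bounds m (hw1 x) (hh1 x)).1,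
    fun x => ?_, fun x hx => ?_⟩
  · rw [abs_mul]; exact mul_le_one₀ (hg1 x) (abs_nonneg _) (hh1 x)
  · convert c₂ using 1; ring
  · have h1 := (mulApprox_bounds m (hw1 x) (hh1 x)).2
    have h2 : |w x * h x - g x * h x| ≤ l * (1 / 4) ^ m := by
      rw [← sub_mul, abs_mul]
      exact (mul_le_of_le_one_right (abs_nonneg _) (hh1 x)).trans (hwg x)
    have h3 := abs_sub_le (ReLU3D.mulApprox m (w x) (h x)) (w x * h x) (g x * h x)
    push_cast
    linarith
  · rcases mul_eq_zero.1 hx with h0 | h0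
    · simp only [hw0 x h0, mulApprox_zero_left]
    · simp only [h0, mulApprox_zero_right]

lemma ApproxComputable.mul_pow (hg : ApproxComputable m l g) (hh : IsFactor h) (k : ℕ) :
    ApproxComputable m (l + k) (fun x => g x * h x ^ k) := by
  induction k with
  | zero => simpa using hg
  | succ k ih => simpa only [pow_succ, mul_assoc, add_assoc] using ih.mul hh

lemma approxComputable_prod {ι : Type*} (s : Finset ι) (φ v : ι → (Fin d → ℝ) → ℝ)
    (hφ : ∀ i, IsFactor (φ i)) (hv : ∀ i, IsFactor (v i)) (k : ι → ℕ) (m : ℕ) :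
    ApproxComputable m (∑ i ∈ s, (1 + k i)) (fun x => ∏ i ∈ s, φ i x * v i x ^ k i) := by
  classical
  induction s using Finset.induction_on with
  | empty => simpa using approxComputable_one m
  | insert i s hi ih =>
    have := (ih.mul (hφ i)).mul_pow (hv i) (k i)
    simp only [Finset.prod_insert hi, Finset.sum_insert hi]
    convert this using 1
    · ring
    · ext x; ring

end

/-! ### Hat functions and truncated coordinates -/

/-- The hat function of height `1` supported on `[-1, 1]`. -/
noncomputable def hat (t : ℝ) : ℝ := max (t + 1) 0 - 2 * max t 0 + max (t - 1) 0

/-- The truncation of `t` to `[-1, 1]`. -/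
noncomputable def clip (t : ℝ) : ℝ := max (t + 1) 0 - max (t - 1) 0 - 1

lemma hat_eq (t : ℝ) : hat t = max (1 - |t|) 0 := by
  unfold hat
  rcases le_total t 0 with h0 | h0
  · rw [max_eq_right h0, max_eq_right (by linarith : t - 1 ≤ 0), abs_of_nonpos h0]
    ring_nf
  · rw [max_eq_left h0, max_eq_left (by linarith : 0 ≤ t + 1), abs_of_nonneg h0]
    rcases le_total t 1 with h1 | h1
    · rw [max_eq_right (by linarith), max_eq_left (by linarith)]; ring
    · rw [max_eq_left (by linarith), max_eq_right (by linarith)]; ring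

lemma hat_nonneg (t : ℝ) : 0 ≤ hat t := by rw [hat_eq]; exact le_max_right _ _

lemma hat_le_one (t : ℝ) : hat t ≤ 1 := by
  rw [hat_eq]; exact max_le (by linarith [abs_nonneg t]) zero_le_one

lemma hat_eq_zero {t : ℝ} (h : 1 ≤ |t|) : hat t = 0 := by
  rw [hat_eq]; exact max_eq_right (by linarith)

lemma abs_clip_le (t : ℝ) : |clip t| ≤ 1 := by
  unfold clip
  rw [abs_le]
  rcases le_total (t + 1) 0 with h | h <;> rcases le_total (t - 1) 0 with h' | h' <;>
    simp only [max_eq_left, max_eq_right, h, h'] <;> constructor <;> linarith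

lemma clip_eq_self {t : ℝ} (h : |t| ≤ 1) : clip t = t := by
  obtain ⟨h1, h2⟩ := abs_le.1 h
  rw [clip, max_eq_left (by linarith), max_eq_right (by linarith)]
  ring

lemma isFactor_hat {d : ℕ} (j : Fin d) (a b : ℝ) : IsFactor fun x => hat (a * x j + b) := by
  refine ⟨fun x => ?_, fun n V hV => ?_⟩
  · rw [abs_of_nonneg (hat_nonneg _)]; exact hat_le_one _
  · have ht : (fun x : Fin d → ℝ => a * x j + b) ∈ V :=
      add_mem (V.smul_mem a (hV.coord_mem j)) (hV.const_mem b)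
    obtain ⟨V₁, c₁, l₁, m₁⟩ := hV.relu (add_mem ht (hV.const_mem 1))
    obtain ⟨V₂, c₂, l₂, m₂⟩ := c₁.relu (l₁ ht)
    obtain ⟨V₃, c₃, l₃, m₃⟩ := c₂.relu (l₂ (l₁ (sub_mem ht (hV.const_mem 1))))
    exact ⟨V₃, c₃, l₁.trans (l₂.trans l₃),
      add_mem (sub_mem (l₃ (l₂ m₁)) (V₃.smul_mem 2 (l₃ m₂))) m₃⟩

lemma isFactor_clip {d : ℕ} (j : Fin d) (a b : ℝ) : IsFactor fun x => clip (a * x j + b) := by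
  refine ⟨fun x => abs_clip_le _, fun n V hV => ?_⟩
  have ht : (fun x : Fin d → ℝ => a * x j + b) ∈ V :=
    add_mem (V.smul_mem a (hV.coord_mem j)) (hV.const_mem b)
  obtain ⟨V₁, c₁, l₁, m₁⟩ := hV.relu (add_mem ht (hV.const_mem 1))
  obtain ⟨V₂, c₂, l₂, m₂⟩ := c₁.relu (l₁ (sub_mem ht (hV.const_mem 1)))
  obtain ⟨V₃, c₃, l₃⟩ := c₂.mono (Nat.le_succ _)
  exact ⟨V₃, c₃, l₁.trans (l₂.trans l₃),
    sub_mem (sub_mem (l₃ (l₂ m₁)) (l₃ m₂)) (c₃.const_mem 1)⟩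

/-- The hats centred at `-P, …, P` form a partition of unity on `[-P, P]`. -/
lemma sum_hat_le_one (P : ℕ) (t : ℝ) :
    ∑ i : Fin (2 * P + 1), hat (t - ((i : ℕ) - P)) ≤ 1 ∧
      (|t| ≤ P → ∑ i : Fin (2 * P + 1), hat (t - ((i : ℕ) - P)) = 1) := by
  -- the sum of consecutive hats telescopes to a trapezoid
  have key : ∀ (n : ℕ) (s : ℝ), ∑ i ∈ Finset.range n, hat (s - i) =
      (max (s + 1) 0 - max s 0) - (max (s + 1 - n) 0 - max (s - n) 0) := by
    intro n s
    induction n with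
    | zero => simp
    | succ n ih =>
      rw [Finset.sum_range_succ, ih, hat]
      push_cast
      ring_nf
  have e : ∑ i : Fin (2 * P + 1), hat (t - ((i : ℕ) - P)) =
      ∑ i ∈ Finset.range (2 * P + 1), hat (t + P - i) := by
    rw [← Fin.sum_univ_eq_sum_range (fun i => hat (t + P - i))]
    refine Finset.sum_congr rfl fun i _ => ?_
    congr 1; ring
  rw [e, key]
  push_cast
  constructor
  · have h1 : max (t + P + 1) 0 ≤ max (t + P) 0 + 1 :=
      max_le (by linarith [le_max_left (t + P) 0]) (by linarith [le_max_right (t + P) 0])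
    have h2 : max (t + P - (2 * P + 1)) 0 ≤ max (t + P + 1 - (2 * P + 1)) 0 :=
      max_le_max (by linarith) le_rfl
    linarith
  · intro ht
    obtain ⟨h1, h2⟩ := abs_le.1 ht
    rw [max_eq_left (by linarith), max_eq_left (by linarith), max_eq_right (by linarith),
      max_eq_right (by linarith)]
    ring

end ReLU3D

/-! ### Interpolation at roots of unity -/

/-- Averaging over the `n`-th roots of unity picks out an exponent. -/
lemma IsPrimitiveRoot.sum_pow_mul_inv_pow {n : ℕ} (hn : 0 < n) {ω : ℂ} (hω : IsPrimitiveRoot ω n)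
    {i k : ℕ} (hi : i < n) (hk : k < n) :
    ∑ m : Fin n, (ω ^ (m : ℕ)) ^ i * ((ω ^ (m : ℕ))⁻¹) ^ k = if i = k then (n : ℂ) else 0 := by
  have hω0 : ω ≠ 0 := hω.ne_zero hn.ne'
  have e : ∀ m : Fin n, (ω ^ (m : ℕ)) ^ i * ((ω ^ (m : ℕ))⁻¹) ^ k = (ω ^ i * (ω⁻¹) ^ k) ^ (m : ℕ) := by
    intro m
    rw [mul_pow, ← pow_mul, ← inv_pow, ← pow_mul, ← pow_mul, ← pow_mul, mul_comm i, mul_comm k]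
  simp only [e]
  rw [Fin.sum_univ_eq_sum_range (fun m => (ω ^ i * (ω⁻¹) ^ k) ^ m)]
  split_ifs with h
  · subst h
    simp [hω0]
  · have h1 : ω ^ i * (ω⁻¹) ^ k ≠ 1 := by
      intro h1
      rw [inv_pow, mul_inv_eq_one₀ (pow_ne_zero _ hω0)] at h1
      exact h (hω.pow_inj hi hk h1)
    have h2 : (ω ^ i * (ω⁻¹) ^ k) ^ n = 1 := by
      rw [mul_pow, ← pow_mul, ← pow_mul, mul_comm i, mul_comm k, pow_mul, pow_mul, inv_pow,
        hω.pow_eq_one]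
      simp
    rw [geom_sum_eq h1, h2]
    simp

/-- The polynomial interpolating a holomorphic function at the `n`-th roots of unity: its
coefficients are averages of the function, and on the unit disc its error is that of the Taylor
polynomial up to a factor two, since a power `z ^ k` is interpolated by `z ^ (k % n)`. -/
lemma exists_interpolation {n : ℕ} (hn : 0 < n) : ∃ (p : Fin n → ℂ) (c : Fin n → Fin n → ℂ),
    (∀ m, ‖p m‖ ≤ 1) ∧ (∀ m k, ‖c m k‖ ≤ 1 / n) ∧
    ∀ (g : ℂ → ℂ) (M : ℝ), DifferentiableOn ℂ g (Metric.closedBall 0 2) →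
      (∀ z, ‖z‖ ≤ 2 → ‖g z‖ ≤ M) → ∀ z, ‖z‖ ≤ 1 →
      ‖g z - ∑ m, g (p m) * ∑ k : Fin n, c m k * z ^ (k : ℕ)‖ ≤ 4 * M * (1 / 2) ^ n := by
  set ω : ℂ := Complex.exp (2 * Real.pi * Complex.I / n)
  have hω : IsPrimitiveRoot ω n := Complex.isPrimitiveRoot_exp n hn.ne'
  have hnorm : ‖ω‖ = 1 := hω.norm'_eq_one hn.ne'
  have hn' : (0 : ℝ) < n := by exact_mod_cast hn
  have hnC : (n : ℂ) ≠ 0 := by exact_mod_cast hn.ne'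
  refine ⟨fun m => ω ^ (m : ℕ), fun m k => (1 / n) * ((ω ^ (m : ℕ))⁻¹) ^ (k : ℕ),
    fun m => by simp [hnorm], fun m k => by simp [hnorm], ?_⟩
  intro g M hg hM z hz
  have hM0 : 0 ≤ M := (norm_nonneg _).trans (hM 0 (by simp))
  set a : ℕ → ℂ := fun k => ((k.factorial : ℂ)⁻¹) * iteratedDeriv k g 0
  have hg' : DifferentiableOn ℂ g (Metric.ball 0 2) := hg.mono Metric.ball_subset_closedBall
  have hsum : ∀ y : ℂ, ‖y‖ ≤ 1 → HasSum (fun k => a k * y ^ k) (g y) := by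
    intro y hy
    have e : (fun k => a k * y ^ k) =
        fun k => ((k.factorial : ℂ)⁻¹) • (y - 0) ^ k • iteratedDeriv k g 0 := by
      funext k
      simp only [a, sub_zero, smul_eq_mul]
      ring
    rw [e]
    exact Complex.hasSum_taylorSeries_on_ball (r := 2) hg'
      (by rw [mem_ball_zero_iff]; linarith)
  have hcl : DiffContOnCl ℂ g (Metric.ball 0 2) := by
    refine ⟨hg', ?_⟩
    rw [closure_ball _ (by norm_num)]
    exact hg.continuousOn
  have ha : ∀ k, ‖a k‖ ≤ M * (1 / 2) ^ k := by
    intro k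
    have := Complex.norm_iteratedDeriv_le_of_forall_mem_sphere_norm_le k (by norm_num) hcl
      (C := M) (fun y hy => hM y (by rw [mem_sphere_zero_iff_norm] at hy; exact hy.le))
    have hf : (0 : ℝ) < k.factorial := by exact_mod_cast k.factorial_pos
    simp only [a, norm_mul, norm_inv, Complex.norm_natCast]
    rw [inv_mul_le_iff₀ hf, one_div, inv_pow]
    calc _ ≤ _ := this
      _ = _ := by ring
  -- the interpolant of the `k`-th power
  set I : ℕ → ℂ := fun k => ∑ m : Fin n, (ω ^ (m : ℕ)) ^ k *
    ∑ l : Fin n, (1 / n) * ((ω ^ (m : ℕ))⁻¹) ^ (l : ℕ) * z ^ (l : ℕ)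
  have hI : ∀ k < n, I k = z ^ k := by
    intro k hk
    simp only [I, Finset.mul_sum]
    rw [Finset.sum_comm]
    have hl : ∀ l : Fin n, ∑ m : Fin n, (ω ^ (m : ℕ)) ^ k *
        ((1 / n) * ((ω ^ (m : ℕ))⁻¹) ^ (l : ℕ) * z ^ (l : ℕ)) =
        if l = ⟨k, hk⟩ then z ^ k else 0 := by
      intro l
      calc _ = (1 / n) * z ^ (l : ℕ) *
            ∑ m : Fin n, (ω ^ (m : ℕ)) ^ k * ((ω ^ (m : ℕ))⁻¹) ^ (l : ℕ) := by
              rw [Finset.mul_sum]; exact Finset.sum_congr rfl fun _ _ => by ring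
        _ = _ := by
          rw [hω.sum_pow_mul_inv_pow hn hk l.2]
          by_cases h : l = ⟨k, hk⟩
          · subst h; simp; field_simp
          · have : k ≠ l := fun h' => h (Fin.ext h'.symm)
            simp [h, this]
    rw [Finset.sum_congr rfl fun l _ => hl l]
    simp
  have hper : ∀ k, I k = I (k % n) := by
    intro k
    simp only [I]
    refine Finset.sum_congr rfl fun m _ => ?_
    congr 1
    have h1 : ω ^ k = ω ^ (k % n) := by
      conv_lhs => rw [← Nat.div_add_mod k n, pow_add, pow_mul, hω.pow_eq_one, one_pow, one_mul]
    rw [← pow_mul, ← pow_mul, mul_comm, pow_mul, mul_comm _ (k % n), pow_mul, h1]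
  have hI1 : ∀ k, ‖z ^ k - I k‖ ≤ if k < n then 0 else 2 := by
    intro k
    split_ifs with h
    · simp [hI k h]
    · rw [hper k, hI _ (Nat.mod_lt _ hn)]
      calc _ ≤ ‖z ^ k‖ + ‖z ^ (k % n)‖ := norm_sub_le _ _
        _ ≤ 1 + 1 := by
          rw [norm_pow, norm_pow]
          exact add_le_add (pow_le_one₀ (norm_nonneg _) hz) (pow_le_one₀ (norm_nonneg _) hz)
        _ = 2 := by norm_num
  have hS : HasSum (fun k => a k * (z ^ k - I k)) (g z - ∑ m : Fin n, g (ω ^ (m : ℕ)) *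
      ∑ k : Fin n, (1 / n) * ((ω ^ (m : ℕ))⁻¹) ^ (k : ℕ) * z ^ (k : ℕ)) := by
    have h2 : HasSum (fun k => a k * I k) (∑ m : Fin n, g (ω ^ (m : ℕ)) *
        ∑ k : Fin n, (1 / n) * ((ω ^ (m : ℕ))⁻¹) ^ (k : ℕ) * z ^ (k : ℕ)) := by
      have := hasSum_sum (s := (Finset.univ : Finset (Fin n))) (fun (m : Fin n) _ =>
        (hsum (ω ^ (m : ℕ)) (by simp [hnorm])).mul_right
          (∑ k : Fin n, (1 / n) * ((ω ^ (m : ℕ))⁻¹) ^ (k : ℕ) * z ^ (k : ℕ)))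
      refine this.congr_fun ?_
      intro k
      simp only [I, Finset.mul_sum, mul_assoc]
    refine ((hsum z hz).sub h2).congr_fun ?_
    intro k; ring
  have hb : HasSum (fun k => if k < n then 0 else 2 * M * (1 / 2 : ℝ) ^ k)
      (4 * M * (1 / 2) ^ n) := by
    rw [← hasSum_nat_add_iff' n]
    have h0 : ∑ i ∈ Finset.range n, (if i < n then 0 else 2 * M * (1 / 2 : ℝ) ^ i) = 0 :=
      Finset.sum_eq_zero fun i hi => if_pos (Finset.mem_range.1 hi)
    rw [h0, sub_zero]
    have := hasSum_geometric_two.mul_left (2 * M * (1 / 2 : ℝ) ^ n)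
    have e : (fun k => if k + n < n then 0 else 2 * M * (1 / 2 : ℝ) ^ (k + n)) =
        fun k => 2 * M * (1 / 2 : ℝ) ^ n * (1 / 2) ^ k := by
      funext k
      rw [if_neg (by omega), pow_add]; ring
    rw [e, show 4 * M * (1 / 2 : ℝ) ^ n = 2 * M * (1 / 2) ^ n * 2 by ring]
    exact this
  have := tsum_of_norm_bounded hb (f := fun k => a k * (z ^ k - I k)) fun k => by
    rw [norm_mul]
    split_ifs with h
    · have := hI1 k
      rw [if_pos h] at this
      have := mul_le_mul_of_nonneg_left this (norm_nonneg (a k))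
      simpa using this
    · have h2 := hI1 k
      rw [if_neg h] at h2
      calc _ ≤ (M * (1 / 2) ^ k) * 2 := mul_le_mul (ha k) h2 (norm_nonneg _) (by positivity)
        _ = _ := by ring
  rwa [hS.tsum_eq] at this

/-- Polynomial approximation of a function that is bounded and separately holomorphic on the
polydisc of radius `2`, with degree less than `n` in each variable. One variable is interpolated at
a time, so that only holomorphy in single variables is used. -/
lemma exists_polynomial_approx {n : ℕ} (hn : 0 < n) {M : ℝ} (d : ℕ) (G : (Fin d → ℂ) → ℂ)
    (hG : ∀ z : Fin d → ℂ, (∀ j, ‖z j‖ ≤ 2) → ∀ j,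
      DifferentiableOn ℂ (fun w => G (Function.update z j w)) (Metric.closedBall 0 2))
    (hM : ∀ z : Fin d → ℂ, (∀ j, ‖z j‖ ≤ 2) → ‖G z‖ ≤ M) :
    ∃ a : (Fin d → Fin n) → ℂ, (∀ k, ‖a k‖ ≤ M) ∧ ∀ z : Fin d → ℂ, (∀ j, ‖z j‖ ≤ 1) →
      ‖G z - ∑ k, a k * ∏ j, z j ^ (k j : ℕ)‖ ≤ d * (4 * M * (1 / 2) ^ n * n ^ d) := by
  obtain ⟨p, c, hp, hc, hI⟩ := exists_interpolation hn
  have hn1 : (1 : ℝ) ≤ n := by exact_mod_cast hn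
  induction d with
  | zero =>
    refine ⟨fun _ => G 0, fun _ => hM 0 (by simp), fun z _ => ?_⟩
    simp [Subsingleton.elim z 0]
  | succ d ih =>
    have hM0 : 0 ≤ M := (norm_nonneg _).trans (hM 0 (by simp))
    have hcons : ∀ (w : ℂ) (z : Fin d → ℂ), ‖w‖ ≤ 2 → (∀ j, ‖z j‖ ≤ 2) →
        ∀ j, ‖(Fin.cons w z : Fin (d + 1) → ℂ) j‖ ≤ 2 := by
      intro w z hw hz j
      refine Fin.cases ?_ (fun j => ?_) j
      · simpa using hw
      · simpa using hz j
    have ih' : ∀ m : Fin n, _ := fun m => ih (fun z => G (Fin.cons (p m) z))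
      (fun z hz j => by
        have := hG (Fin.cons (p m) z) (hcons _ _ ((hp m).trans (by norm_num)) hz) j.succ
        simpa only [Fin.cons_update] using this)
      (fun z hz => hM _ (hcons _ _ ((hp m).trans (by norm_num)) hz))
    choose a ha hb using ih'
    refine ⟨fun k => ∑ m, c m (k 0) * a m (Fin.tail k), fun k => ?_, fun z hz => ?_⟩
    · calc _ ≤ ∑ m, ‖c m (k 0) * a m (Fin.tail k)‖ := norm_sum_le _ _
        _ ≤ ∑ m : Fin n, (1 / n) * M := Finset.sum_le_sum fun m _ => by
          rw [norm_mul]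
          exact mul_le_mul (hc _ _) (ha _ _) (norm_nonneg _) (by positivity)
        _ = M := by
          rw [Finset.sum_const, Finset.card_univ, Fintype.card_fin, nsmul_eq_mul]
          field_simp
    · set ℓ : Fin n → ℂ := fun m => ∑ k : Fin n, c m k * z 0 ^ (k : ℕ)
      set Q : Fin n → ℂ := fun m => ∑ k, a m k * ∏ j, Fin.tail z j ^ (k j : ℕ)
      have hz' : ∀ j, ‖Fin.tail z j‖ ≤ 1 := fun j => hz j.succ
      have hℓ : ∀ m, ‖ℓ m‖ ≤ 1 := by
        intro m
        calc _ ≤ ∑ k : Fin n, ‖c m k * z 0 ^ (k : ℕ)‖ := norm_sum_le _ _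
          _ ≤ ∑ k : Fin n, (1 / n : ℝ) := Finset.sum_le_sum fun k _ => by
            rw [norm_mul, norm_pow]
            exact (mul_le_of_le_one_right (norm_nonneg _)
              (pow_le_one₀ (norm_nonneg _) (hz 0))).trans (hc _ _)
          _ = 1 := by
            rw [Finset.sum_const, Finset.card_univ, Fintype.card_fin, nsmul_eq_mul]
            field_simp
      have e1 : ∑ k : Fin (d + 1) → Fin n, (∑ m, c m (k 0) * a m (Fin.tail k)) *
          ∏ j, z j ^ (k j : ℕ) = ∑ m, Q m * ℓ m := by
        rw [← (Fin.consEquiv fun _ : Fin (d + 1) => Fin n).sum_comp, Fintype.sum_prod_type]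
        simp only [Fin.consEquiv_apply, Fin.cons_zero, Fin.prod_univ_succ, Fin.cons_succ]
        calc _ = ∑ i : Fin n, ∑ k : Fin d → Fin n, ∑ m, (a m k * ∏ j, Fin.tail z j ^ (k j : ℕ)) *
              (c m i * z 0 ^ (i : ℕ)) := by
              refine Finset.sum_congr rfl fun i _ => Finset.sum_congr rfl fun k _ => ?_
              rw [Finset.sum_mul]
              refine Finset.sum_congr rfl fun m _ => ?_
              have ht : Fin.tail ((Fin.consEquiv fun _ : Fin (d + 1) => Fin n) (i, k)) = k := rfl
              rw [ht]
              simp only [Fin.tail]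
              ring
          _ = ∑ i : Fin n, ∑ m, ∑ k : Fin d → Fin n, (a m k * ∏ j, Fin.tail z j ^ (k j : ℕ)) *
              (c m i * z 0 ^ (i : ℕ)) := Finset.sum_congr rfl fun i _ => Finset.sum_comm
          _ = ∑ m, ∑ i : Fin n, ∑ k : Fin d → Fin n, (a m k * ∏ j, Fin.tail z j ^ (k j : ℕ)) *
              (c m i * z 0 ^ (i : ℕ)) := Finset.sum_comm
          _ = _ := by
              refine Finset.sum_congr rfl fun m _ => ?_
              rw [Finset.sum_comm, Finset.sum_mul_sum]
      rw [e1]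
      have e2 : ‖G z - ∑ m, G (Fin.cons (p m) (Fin.tail z)) * ℓ m‖ ≤ 4 * M * (1 / 2) ^ n := by
        have h1 : DifferentiableOn ℂ (fun w => G (Fin.cons w (Fin.tail z)))
            (Metric.closedBall 0 2) := by
          have := hG z (fun j => (hz j).trans (by norm_num)) 0
          have e : ∀ w, Function.update z 0 w = Fin.cons w (Fin.tail z) := fun w => by
            conv_lhs => rw [← Fin.cons_self_tail z, Fin.update_cons_zero]
          simpa only [e] using this
        have := hI _ M h1 (fun w hw => hM _ (hcons _ _ hw fun j => (hz' j).trans (by norm_num)))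
          (z 0) (hz 0)
        simpa only [Fin.cons_self_tail] using this
      have e3 : ‖∑ m, G (Fin.cons (p m) (Fin.tail z)) * ℓ m - ∑ m, Q m * ℓ m‖ ≤
          n * (d * (4 * M * (1 / 2) ^ n * n ^ d)) := by
        rw [← Finset.sum_sub_distrib]
        calc _ ≤ ∑ m : Fin n, ‖G (Fin.cons (p m) (Fin.tail z)) * ℓ m - Q m * ℓ m‖ :=
              norm_sum_le _ _
          _ ≤ ∑ m : Fin n, d * (4 * M * (1 / 2) ^ n * n ^ d) := Finset.sum_le_sum fun m _ => by
            rw [← sub_mul, norm_mul]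
            exact (mul_le_of_le_one_right (norm_nonneg _) (hℓ m)).trans (hb m _ hz')
          _ = _ := by simp
      have hpow : (1 : ℝ) ≤ n ^ (d + 1) := one_le_pow₀ hn1
      have hE : 0 ≤ 4 * M * (1 / 2 : ℝ) ^ n := by positivity
      calc _ ≤ _ := norm_sub_le_norm_sub_add_norm_sub _
              (∑ m, G (Fin.cons (p m) (Fin.tail z)) * ℓ m) _
        _ ≤ 4 * M * (1 / 2) ^ n + n * (d * (4 * M * (1 / 2) ^ n * n ^ d)) := add_le_add e2 e3
        _ ≤ 4 * M * (1 / 2) ^ n * n ^ (d + 1) + n * (d * (4 * M * (1 / 2) ^ n * n ^ d)) := by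
          exact add_le_add_left (le_mul_of_one_le_right hE hpow) _
        _ = _ := by push_cast; ring

/-! ### The Gaussian weight -/

/-- The weight `exp (∑ (x_j² / 4 - a |x_j|))`. The product of its square and the Gaussian density is
a multiple of `exp (-2a ∑ |x_j|)`, so the weight is square integrable for `a > 0`. -/
noncomputable def gaussWeight {d : ℕ} (a : ℝ) (x : Fin d → ℝ) : ℝ :=
  Real.exp (∑ j, (x j ^ 2 / 4 - a * |x j|))

lemma integrable_exp_sq_sub_abs {a : ℝ} (ha : 0 < a) :
    Integrable (fun x : ℝ => Real.exp (x ^ 2 / 4 - a * |x|) ^ 2) (gaussianReal 0 1) := by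
  rw [gaussianReal_of_var_ne_zero _ one_ne_zero]
  have hm : Measurable (gaussianPDF 0 1) := measurable_gaussianPDF 0 1
  rw [integrable_withDensity_iff_integrable_smul' hm (by simp [gaussianPDF])]
  have hexp : Integrable fun x : ℝ => Real.exp (-(2 * a) * |x|) := by
    have h1 : IntegrableOn (fun x : ℝ => Real.exp (-(2 * a) * |x|)) (Set.Ioi 0) :=
      (exp_neg_integrableOn_Ioi 0 (by positivity : (0 : ℝ) < 2 * a)).congr_fun
        (fun x hx => by simp only; rw [abs_of_pos hx]) measurableSet_Ioi
    have h2 : IntegrableOn (fun x : ℝ => Real.exp (-(2 * a) * |x|)) (Set.Iic 0) :=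
      (integrableOn_exp_mul_Iic (by positivity : (0 : ℝ) < 2 * a) 0).congr_fun
        (fun x hx => by simp only; rw [abs_of_nonpos hx]; ring_nf) measurableSet_Iic
    rw [← integrableOn_univ, ← Set.Iic_union_Ioi (a := (0 : ℝ))]
    exact h2.union h1
  refine (hexp.const_mul (√(2 * Real.pi))⁻¹).congr (Filter.Eventually.of_forall fun x => ?_)
  simp only [toReal_gaussianPDF, gaussianPDFReal, smul_eq_mul, NNReal.coe_one, mul_one, sub_zero]
  rw [mul_assoc, ← Real.exp_nat_mul, ← Real.exp_add]
  congr 2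
  push_cast
  ring

lemma memLp_gaussWeight {d : ℕ} {a : ℝ} (ha : 0 < a) :
    MemLp (gaussWeight (d := d) a) 2 (stdGaussianPi d) := by
  have hc : Continuous (gaussWeight (d := d) a) := by
    unfold gaussWeight
    fun_prop
  rw [memLp_two_iff_integrable_sq hc.aestronglyMeasurable]
  have := Integrable.fintype_prod (μ := fun _ : Fin d => gaussianReal 0 1)
    (f := fun _ x => Real.exp (x ^ 2 / 4 - a * |x|) ^ 2) fun _ => integrable_exp_sq_sub_abs ha
  refine this.congr (Filter.Eventually.of_forall fun x => ?_)
  simp only [gaussWeight, Real.exp_sum, Finset.prod_pow]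

/-! ### Approximation by localized polynomials -/

/-- Polynomial approximation on the cell of half-width `b / 2` around the real point `c`. -/
lemma exists_cell_polynomial {d : ℕ} {τ : Fin d → ℝ} {F : (Fin d → ℂ) → ℂ} {A b : ℝ} (hb : 0 < b)
    (hA : 0 < A) (hbτ : ∀ j, b < τ j) (hF : DifferentiableOn ℂ F (complexStrip τ))
    (hFA : ∀ z : Fin d → ℂ, (∀ j, |(z j).im| ≤ b) → ‖F z‖ ≤ A * Real.exp (∑ j, (z j).re ^ 2 / 4))
    {n : ℕ} (hn : 0 < n) (c : Fin d → ℝ) :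
    ∃ p : (Fin d → Fin n) → ℝ,
      (∀ k, |p k| ≤ A * Real.exp (∑ j, (|c j| + b) ^ 2 / 4)) ∧
      ∀ v : Fin d → ℝ, (∀ j, |v j| ≤ 1) →
        |(F fun j => ((c j + b / 2 * v j : ℝ) : ℂ)).re - ∑ k, p k * ∏ j, v j ^ (k j : ℕ)| ≤
          d * (4 * (A * Real.exp (∑ j, (|c j| + b) ^ 2 / 4)) * (1 / 2) ^ n * n ^ d) := by
  set M := A * Real.exp (∑ j, (|c j| + b) ^ 2 / 4)
  have him : ∀ (w : ℂ) (j : Fin d), ‖w‖ ≤ 2 → |((c j : ℂ) + (b / 2 : ℝ) * w).im| ≤ b := by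
    intro w j hw
    have : ((c j : ℂ) + (b / 2 : ℝ) * w).im = b / 2 * w.im := by simp
    rw [this, abs_mul, abs_of_pos (by positivity)]
    have := (Complex.abs_im_le_norm w).trans hw
    nlinarith
  have hre : ∀ (w : ℂ) (j : Fin d), ‖w‖ ≤ 2 → |((c j : ℂ) + (b / 2 : ℝ) * w).re| ≤ |c j| + b := by
    intro w j hw
    have : ((c j : ℂ) + (b / 2 : ℝ) * w).re = c j + b / 2 * w.re := by simp
    rw [this]
    refine (abs_add_le _ _).trans ?_
    rw [abs_mul, abs_of_pos (by positivity : 0 < b / 2)]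
    have := (Complex.abs_re_le_norm w).trans hw
    nlinarith
  obtain ⟨a, ha, hE⟩ := exists_polynomial_approx (M := M) hn d
    (fun z => F fun j => (c j : ℂ) + (b / 2 : ℝ) * z j)
    (by
      intro z hz j₀
      refine hF.comp ?_ ?_
      · refine Differentiable.differentiableOn ?_
        rw [differentiable_pi]
        intro j
        by_cases h : j = j₀
        · subst h; simp only [Function.update_self]; fun_prop
        · simp only [Function.update_of_ne h]; fun_prop
      · intro w hw j
        rw [mem_closedBall_zero_iff] at hw
        refine (him _ j ?_).trans_lt (hbτ j)
        by_cases h : j = j₀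
        · subst h; simpa using hw
        · simpa [Function.update_of_ne h] using hz j)
    (by
      intro z hz
      refine (hFA _ fun j => him _ j (hz j)).trans ?_
      refine mul_le_mul_of_nonneg_left (Real.exp_le_exp.2 ?_) hA.le
      refine Finset.sum_le_sum fun j _ => ?_
      rw [← sq_abs]
      have := hre (z j) j (hz j)
      gcongr)
  refine ⟨fun k => (a k).re, fun k => (Complex.abs_re_le_norm _).trans (ha k), fun v hv => ?_⟩
  have h1 := hE (fun j => (v j : ℂ)) fun j => by simpa using hv j
  refine le_trans ?_ h1
  refine le_trans (le_of_eq ?_) (Complex.abs_re_le_norm _)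
  rw [Complex.sub_re, Complex.re_sum]
  congr 2
  · congr 2; ext j; push_cast; rfl
  · refine Finset.sum_congr rfl fun k _ => ?_
    have : (∏ j, (v j : ℂ) ^ (k j : ℕ)) = ((∏ j, v j ^ (k j : ℕ) : ℝ) : ℂ) := by push_cast; rfl
    rw [this, Complex.re_mul_ofReal]

namespace ReLU3D

/-- A function with holomorphic continuation of Gaussian growth is approximated by a network whose
first layer multiplies, on each of `(2P + 1)^d` cells of side `b`, a product of hat functions with
the monomials of degree less than `n` in each variable. The first error term comes from the region
outside the cells, the second one from interpolation and from inexact multiplication. -/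
lemma exists_network_approx {d : ℕ} {τ : Fin d → ℝ} {f : (Fin d → ℝ) → ℝ} {F : (Fin d → ℂ) → ℂ}
    {A a b : ℝ} (ha : 0 < a) (hb : 0 < b) (hA : 0 < A) (hbτ : ∀ j, b < τ j)
    (hF : IsHolomorphicContinuation τ f F)
    (hFA : ∀ z : Fin d → ℂ, (∀ j, |(z j).im| ≤ b) → ‖F z‖ ≤ A * Real.exp (∑ j, (z j).re ^ 2 / 4))
    (hfA : ∀ x, |f x| ≤ A * gaussWeight (2 * a) x) {P n : ℕ} (hn : 0 < n) {W K H B : ℕ}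
    (hW : 2 ≤ W) (hK : 1 ≤ K) (hH : 1 ≤ H) (hBH : B * (d * n * (2 * n + 5) + 2) ≤ H)
    (hBW : ((2 * P + 1) * n) ^ d ≤ B * W) :
    ∃ Φ ∈ networks d W K H, ∀ x, |f x - Φ x| ≤
      A * (Real.exp (-(a * (b / 2 * P))) + (2 * P + 1) ^ d * (Real.exp (d * (2 * b ^ 2 + a * b) *
        (P + 1)) * (5 * d * n ^ (d + 1) * (1 / 2) ^ n))) * gaussWeight a x := by
  obtain ⟨hFd, hFf⟩ := hF
  set t : Fin (2 * P + 1) → ℝ := fun i => (i : ℕ) - P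
  have htP : ∀ i, |t i| ≤ P := by
    intro i
    have h1 : ((i : ℕ) : ℝ) ≤ 2 * P := by exact_mod_cast Nat.lt_succ_iff.1 i.2
    have h2 : (0 : ℝ) ≤ (i : ℕ) := Nat.cast_nonneg _
    simp only [t, abs_le]
    constructor <;> linarith
  -- local coordinates, equal to `x j / (b / 2) - t (κ j)`
  set y : (Fin d → Fin (2 * P + 1)) → Fin d → (Fin d → ℝ) → ℝ :=
    fun κ j x => (b / 2)⁻¹ * x j + -t (κ j)
  have hyx : ∀ κ j x, x j = b / 2 * t (κ j) + b / 2 * y κ j x := by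
    intro κ j x
    simp only [y]
    field_simp
    ring
  choose p hp hpE using fun κ : Fin d → Fin (2 * P + 1) =>
    exists_cell_polynomial hb hA hbτ hFd hFA hn (fun j => b / 2 * t (κ j))
  have hprog : ∀ i : (Fin d → Fin (2 * P + 1)) × (Fin d → Fin n),
      ∃ u : ℕ → (Fin d → ℝ) → ℝ, IsProgram u (d * n * (2 * n + 5) + 2) ∧
        (∀ x, |(u (d * n * (2 * n + 5)) x - u (d * n * (2 * n + 5) + 1) x) -
          ∏ j, hat (y i.1 j x) * clip (y i.1 j x) ^ (i.2 j : ℕ)| ≤ d * n * (1 / 4) ^ n) ∧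
        ∀ x, ∏ j, hat (y i.1 j x) * clip (y i.1 j x) ^ (i.2 j : ℕ) = 0 →
          u (d * n * (2 * n + 5)) x - u (d * n * (2 * n + 5) + 1) x = 0 := by
    rintro ⟨κ, k⟩
    obtain ⟨-, V, hV, w, hw, -, hwE, hw0⟩ := approxComputable_prod Finset.univ
      (fun j x => hat (y κ j x)) (fun j x => clip (y κ j x)) (fun j => isFactor_hat _ _ _)
      (fun j => isFactor_clip _ _ _) (fun j => (k j : ℕ)) n
    have hl : ∑ j, (1 + (k j : ℕ)) ≤ d * n := by
      calc _ ≤ ∑ _j : Fin d, n := Finset.sum_le_sum fun j _ => by have := (k j).2; omega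
        _ = d * n := by simp
    obtain ⟨V', hV', hVV'⟩ := hV.mono (Nat.mul_le_mul_right _ hl)
    obtain ⟨u, hu, hue⟩ := hV'.exists_program (hVV' hw)
    refine ⟨u, hu, fun x => ?_, fun x hx => ?_⟩
    · rw [← hue]
      refine (hwE x).trans ?_
      gcongr
      exact_mod_cast hl
    · rw [← hue]
      exact hw0 x hx
  choose u hu huE hu0 using hprog
  refine ⟨_, sum_mem_networks hW hK hH hBH (ι := (Fin d → Fin (2 * P + 1)) × (Fin d → Fin n))
    (by simpa [mul_pow] using hBW) u hu (d * n * (2 * n + 5)) (d * n * (2 * n + 5) + 1)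
    (by omega) (by omega) (fun i => p i.1 i.2), fun x => ?_⟩
  set q : (Fin d → Fin (2 * P + 1)) → (Fin d → Fin n) → ℝ := fun κ k =>
    u (κ, k) (d * n * (2 * n + 5)) x - u (κ, k) (d * n * (2 * n + 5) + 1) x
  set φ : (Fin d → Fin (2 * P + 1)) → ℝ := fun κ => ∏ j, hat (y κ j x) with hφ
  have hφ0 : ∀ κ, 0 ≤ φ κ := fun κ => Finset.prod_nonneg fun j _ => hat_nonneg _
  have hφ1 : ∀ κ, φ κ ≤ 1 := fun κ =>
    Finset.prod_le_one (fun j _ => hat_nonneg _) fun j _ => hat_le_one _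
  have hw0 : 0 < gaussWeight a x := Real.exp_pos _
  have hn1 : (1 : ℝ) ≤ n := by exact_mod_cast hn
  have hcell : ∀ κ, |φ κ * f x - ∑ k, p κ k * q κ k| ≤ A * (Real.exp (d * (2 * b ^ 2 + a * b) *
        (P + 1)) * (5 * d * n ^ (d + 1) * (1 / 2) ^ n)) * gaussWeight a x := by
    intro κ
    by_cases hact : ∀ j, |y κ j x| < 1
    · set M := A * Real.exp (∑ j, (|b / 2 * t (κ j)| + b) ^ 2 / 4) with hM
      have hM0 : 0 < M := by positivity
      have hMle : M ≤ A * (Real.exp (d * (2 * b ^ 2 + a * b) * (P + 1)) * gaussWeight a x) := by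
        rw [hM, gaussWeight, ← Real.exp_add]
        refine mul_le_mul_of_nonneg_left (Real.exp_le_exp.2 ?_) hA.le
        have hd : (d : ℝ) * (2 * b ^ 2 + a * b) * (P + 1) =
            ∑ _j : Fin d, (2 * b ^ 2 + a * b) * (P + 1) := by simp; ring
        rw [hd, ← Finset.sum_add_distrib]
        refine Finset.sum_le_sum fun j _ => ?_
        have h1 : |b / 2 * t (κ j)| ≤ |x j| + b / 2 := by
          have e : b / 2 * t (κ j) = x j - b / 2 * y κ j x := by rw [hyx κ j x]; ring
          rw [e]
          refine (abs_sub _ _).trans ?_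
          rw [abs_mul, abs_of_pos (by positivity : 0 < b / 2)]
          nlinarith [hact j]
        have h2 : |x j| ≤ b * (P + 1) := by
          rw [hyx κ j x]
          refine (abs_add_le _ _).trans ?_
          rw [abs_mul, abs_mul, abs_of_pos (by positivity : 0 < b / 2)]
          nlinarith [hact j, htP (κ j), (Nat.cast_nonneg P : (0 : ℝ) ≤ P)]
        have h3 : (|b / 2 * t (κ j)| + b) ^ 2 ≤ (|x j| + 2 * b) ^ 2 := 
            pow_le_pow_left₀ (by positivity) (by linarith) 2
        have h4 : (|x j| + 2 * b) ^ 2 = x j ^ 2 + 4 * b * |x j| + 4 * b ^ 2 := by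
          rw [add_sq, sq_abs]; ring
        have h5 : b * |x j| ≤ b * (b * (P + 1)) := by gcongr
        have h6 : a * |x j| ≤ a * (b * (P + 1)) := by gcongr
        have h7 : 0 ≤ b ^ 2 * (P : ℝ) := by positivity
        nlinarith
      have hf : |f x - ∑ k, p κ k * ∏ j, clip (y κ j x) ^ (k j : ℕ)| ≤
          d * (4 * M * (1 / 2) ^ n * n ^ d) := by
        have h1 := hpE κ (fun j => y κ j x) fun j => (hact j).le
        have h2 : (fun j => ((b / 2 * t (κ j) + b / 2 * y κ j x : ℝ) : ℂ)) =
            fun j => (x j : ℂ) := by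
          ext j; rw [← hyx]
        rw [h2, hFf, Complex.ofReal_re] at h1
        simpa only [clip_eq_self (hact _).le] using h1
      have hk : ∀ k, |p κ k * (φ κ * ∏ j, clip (y κ j x) ^ (k j : ℕ)) - p κ k * q κ k| ≤
          M * (d * n * (1 / 4) ^ n) := by
        intro k
        rw [← mul_sub, abs_mul]
        refine mul_le_mul (hp κ k) ?_ (abs_nonneg _) hM0.le
        rw [abs_sub_comm, hφ, ← Finset.prod_mul_distrib]
        exact huE (κ, k) x
      have hsplit : φ κ * f x - ∑ k, p κ k * q κ k =
          φ κ * (f x - ∑ k, p κ k * ∏ j, clip (y κ j x) ^ (k j : ℕ)) +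
          ∑ k, (p κ k * (φ κ * ∏ j, clip (y κ j x) ^ (k j : ℕ)) - p κ k * q κ k) := by
        rw [Finset.sum_sub_distrib, mul_sub, Finset.mul_sum]
        have : ∀ k, φ κ * (p κ k * ∏ j, clip (y κ j x) ^ (k j : ℕ)) =
            p κ k * (φ κ * ∏ j, clip (y κ j x) ^ (k j : ℕ)) := fun k => by ring
        simp only [this]
        ring
      have hpow : (1 / 4 : ℝ) ^ n ≤ (1 / 2) ^ n := pow_le_pow_left₀ (by norm_num) (by norm_num) _
      calc _ ≤ φ κ * |f x - ∑ k, p κ k * ∏ j, clip (y κ j x) ^ (k j : ℕ)| +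
            ∑ k, |p κ k * (φ κ * ∏ j, clip (y κ j x) ^ (k j : ℕ)) - p κ k * q κ k| := by
            rw [hsplit]
            refine (abs_add_le _ _).trans (add_le_add ?_ (Finset.abs_sum_le_sum_abs _ _))
            rw [abs_mul, abs_of_nonneg (hφ0 κ)]
        _ ≤ 1 * (d * (4 * M * (1 / 2) ^ n * n ^ d)) +
            ∑ _k : Fin d → Fin n, M * (d * n * (1 / 4) ^ n) :=
            add_le_add (mul_le_mul (hφ1 κ) hf (abs_nonneg _) zero_le_one)
              (Finset.sum_le_sum fun k _ => hk k)
        _ = M * (4 * d * (n ^ d * 1) * (1 / 2) ^ n + d * n ^ (d + 1) * (1 / 4) ^ n) := by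
            rw [Finset.sum_const, Finset.card_univ, Fintype.card_fun, Fintype.card_fin,
              Fintype.card_fin, nsmul_eq_mul]
            push_cast
            ring
        _ ≤ M * (4 * d * (n ^ d * n) * (1 / 2) ^ n + d * n ^ (d + 1) * (1 / 2) ^ n) := by
            gcongr
        _ = M * (5 * d * n ^ (d + 1) * (1 / 2) ^ n) := by ring
        _ ≤ A * (Real.exp (d * (2 * b ^ 2 + a * b) * (P + 1)) * gaussWeight a x) *
            (5 * d * n ^ (d + 1) * (1 / 2) ^ n) := by gcongr
        _ = _ := by ring
    · push Not at hact
      obtain ⟨j, hj⟩ := hact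
      have h0 : φ κ = 0 := Finset.prod_eq_zero (Finset.mem_univ j) (hat_eq_zero hj)
      have hq0 : ∀ k, q κ k = 0 := fun k => hu0 (κ, k) x
        (Finset.prod_eq_zero (Finset.mem_univ j) (by simp only; rw [hat_eq_zero hj, zero_mul]))
      simp only [h0, hq0, zero_mul, mul_zero, Finset.sum_const_zero, sub_zero, abs_zero]
      positivity
  have hsum : ∑ κ, φ κ = ∏ j, ∑ i, hat ((b / 2)⁻¹ * x j + -t i) := by
    rw [Finset.prod_univ_sum, Fintype.piFinset_univ]
  have hyt : ∀ j, ∑ i, hat ((b / 2)⁻¹ * x j + -t i) =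
      ∑ i : Fin (2 * P + 1), hat ((b / 2)⁻¹ * x j - ((i : ℕ) - P)) := fun j => by
    simp only [t, sub_eq_add_neg]
  have hout : |f x - (∑ κ, φ κ) * f x| ≤
      A * Real.exp (-(a * (b / 2 * P))) * gaussWeight a x := by
    by_cases hin : ∀ j, |(b / 2)⁻¹ * x j| ≤ P
    · have h1 : ∑ κ, φ κ = 1 := by
        rw [hsum]
        exact Finset.prod_eq_one fun j _ => by rw [hyt, (sum_hat_le_one P _).2 (hin j)]
      rw [h1, one_mul, sub_self, abs_zero]
      positivity
    · push Not at hin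
      obtain ⟨j, hj⟩ := hin
      have h0 : 0 ≤ ∑ κ, φ κ := Finset.sum_nonneg fun κ _ => hφ0 κ
      have h1 : ∑ κ, φ κ ≤ 1 := by
        rw [hsum]
        refine Finset.prod_le_one (fun j _ => Finset.sum_nonneg fun i _ => hat_nonneg _)
          fun j _ => ?_
        rw [hyt]
        exact (sum_hat_le_one P _).1
      have hj' : b / 2 * P ≤ |x j| := by
        rw [abs_mul, abs_of_pos (by positivity)] at hj
        rw [inv_mul_eq_div, lt_div_iff₀ (by positivity)] at hj
        linarith
      have hj'' : |x j| ≤ ∑ j, |x j| :=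
        Finset.single_le_sum (f := fun j => |x j|) (fun _ _ => abs_nonneg _) (Finset.mem_univ j)
      calc |f x - (∑ κ, φ κ) * f x| = (1 - ∑ κ, φ κ) * |f x| := by
            rw [← one_sub_mul, abs_mul, abs_of_nonneg (by linarith)]
        _ ≤ |f x| := mul_le_of_le_one_left (abs_nonneg _) (by linarith)
        _ ≤ A * gaussWeight (2 * a) x := hfA x
        _ ≤ A * (Real.exp (-(a * (b / 2 * P))) * gaussWeight a x) := by
            rw [gaussWeight, gaussWeight, ← Real.exp_add]
            refine mul_le_mul_of_nonneg_left (Real.exp_le_exp.2 ?_) hA.le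
            rw [Finset.sum_sub_distrib, Finset.sum_sub_distrib, ← Finset.mul_sum, ← Finset.mul_sum]
            nlinarith
        _ = _ := by ring
  have hfin : f x - ∑ i : (Fin d → Fin (2 * P + 1)) × (Fin d → Fin n), p i.1 i.2 *
      (u i (d * n * (2 * n + 5)) x - u i (d * n * (2 * n + 5) + 1) x) =
      (f x - (∑ κ, φ κ) * f x) + ∑ κ, (φ κ * f x - ∑ k, p κ k * q κ k) := by
    rw [Fintype.sum_prod_type, Finset.sum_sub_distrib, Finset.sum_mul]
    ring
  rw [hfin]
  calc _ ≤ _ := abs_add_le _ _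
    _ ≤ A * Real.exp (-(a * (b / 2 * P))) * gaussWeight a x +
        ∑ _κ : Fin d → Fin (2 * P + 1), A * (Real.exp (d * (2 * b ^ 2 + a * b) *
        (P + 1)) * (5 * d * n ^ (d + 1) * (1 / 2) ^ n)) * gaussWeight a x :=
        add_le_add hout ((Finset.abs_sum_le_sum_abs _ _).trans
          (Finset.sum_le_sum fun κ _ => hcell κ))
    _ = _ := by
        rw [Finset.sum_const, Finset.card_univ, Fintype.card_fun, Fintype.card_fin,
          Fintype.card_fin, nsmul_eq_mul]
        push_cast
        ring

end ReLU3D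

/-! ### Choice of the parameters -/

/-- With a number of cells and a degree proportional to `q`, the error is exponentially small
in `q`. -/
lemma exists_parameters (d : ℕ) {s γ B : ℝ} (hs : 0 < s) (hγ : 0 < γ) (hB : 0 < B) :
    ∃ C₁ C₂ : ℕ, 0 < C₁ ∧ 0 < C₂ ∧ ∃ C : ℝ, 0 < C ∧ ∀ q : ℕ, 0 < q →
      Real.exp (-(s * (C₁ * q : ℕ))) + (2 * (C₁ * q : ℕ) + 1) ^ d *
        (Real.exp (γ * ((C₁ * q : ℕ) + 1)) *
          (5 * d * (C₂ * q : ℕ) ^ (d + 1) * (1 / 2) ^ (C₂ * q))) ≤ C * Real.exp (-(B * q)) := by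
  obtain ⟨C₁, hC₁⟩ := exists_nat_gt (B / s)
  have hC₁0 : (0 : ℝ) < C₁ := (by positivity : (0 : ℝ) < B / s).trans hC₁
  have hlog : 0 < Real.log 2 := Real.log_pos (by norm_num)
  obtain ⟨C₂, hC₂⟩ := exists_nat_gt ((γ * C₁ + B + 1) / Real.log 2)
  have hC₂0 : (0 : ℝ) < C₂ := (by positivity : (0 : ℝ) < _).trans hC₂
  rw [div_lt_iff₀ hs] at hC₁
  rw [div_lt_iff₀ hlog] at hC₂
  set D : ℝ := (3 * C₁) ^ d * Real.exp γ * (5 * d * C₂ ^ (d + 1)) * (2 * d + 1).factorial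
  refine ⟨C₁, C₂, by exact_mod_cast hC₁0, by exact_mod_cast hC₂0, 1 + D, by positivity, ?_⟩
  intro q hq
  have hq1 : (1 : ℝ) ≤ q := by exact_mod_cast hq
  have hC₁1 : (1 : ℝ) ≤ C₁ := by exact_mod_cast (by exact_mod_cast hC₁0 : 0 < C₁)
  have h1 : Real.exp (-(s * (C₁ * q : ℕ))) ≤ Real.exp (-(B * q)) := by
    rw [Real.exp_le_exp]
    push_cast
    nlinarith
  have h2 : (2 * ((C₁ * q : ℕ) : ℝ) + 1) ^ d ≤ (3 * C₁ * q) ^ d := by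
    push_cast
    gcongr
    nlinarith
  have h3 : ((1 / 2 : ℝ)) ^ (C₂ * q) = Real.exp (-(C₂ * Real.log 2 * q)) := by
    rw [one_div, ← Real.exp_log (by norm_num : (0 : ℝ) < 2⁻¹), ← Real.exp_nat_mul, Real.log_inv]
    push_cast
    ring_nf
  have h4 : (q : ℝ) ^ (2 * d + 1) ≤ (2 * d + 1).factorial * Real.exp q := by
    have := Real.pow_div_factorial_le_exp (q : ℝ) (by positivity) (2 * d + 1)
    rw [div_le_iff₀ (by positivity)] at this
    linarith
  have h5 : Real.exp (γ * ((C₁ * q : ℕ) + 1)) * (1 / 2) ^ (C₂ * q) ≤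
      Real.exp γ * Real.exp (-(B * q) - q) := by
    rw [h3, ← Real.exp_add, ← Real.exp_add, Real.exp_le_exp]
    push_cast
    nlinarith
  have h6 : (2 * ((C₁ * q : ℕ) : ℝ) + 1) ^ d *
        (Real.exp (γ * ((C₁ * q : ℕ) + 1)) *
          (5 * d * (C₂ * q : ℕ) ^ (d + 1) * (1 / 2) ^ (C₂ * q))) ≤ D * Real.exp (-(B * q)) := by
    calc _ = (2 * ((C₁ * q : ℕ) : ℝ) + 1) ^ d * (5 * d * (C₂ * q : ℕ) ^ (d + 1)) *
          (Real.exp (γ * ((C₁ * q : ℕ) + 1)) * (1 / 2) ^ (C₂ * q)) := by ring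
      _ ≤ (3 * C₁ * q) ^ d * (5 * d * (C₂ * q : ℕ) ^ (d + 1)) *
          (Real.exp γ * Real.exp (-(B * q) - q)) := by gcongr
      _ = (3 * C₁) ^ d * Real.exp γ * (5 * d * C₂ ^ (d + 1)) * q ^ (2 * d + 1) *
          Real.exp (-(B * q) - q) := by
          rw [show 2 * d + 1 = d + (d + 1) by ring, pow_add]
          push_cast
          ring
      _ ≤ (3 * C₁) ^ d * Real.exp γ * (5 * d * C₂ ^ (d + 1)) *
          ((2 * d + 1).factorial * Real.exp q) * Real.exp (-(B * q) - q) := by gcongr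
      _ = D * (Real.exp q * Real.exp (-(B * q) - q)) := by ring
      _ = D * Real.exp (-(B * q)) := by rw [← Real.exp_add]; ring_nf
  linarith

/-- The height grows faster than linearly, whereas the construction needs linear height. -/
lemma le_netHeight {d N : ℕ} (hd : 1 ≤ d) (hN : 1 ≤ N) {B : ℝ} (hB : 0 ≤ B) :
    1 ≤ netHeight d N B ∧ (N : ℝ) * Real.logb 2 N / 4 ≤ netHeight d N B := by
  have hN1 : (1 : ℝ) ≤ N := by exact_mod_cast hN
  have hd1 : (1 : ℝ) ≤ d := by exact_mod_cast hd
  have h2 : (1 : ℝ) < 2 := by norm_num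
  have hlog : 1 ≤ Real.log (6 * N) := by
    rw [Real.le_log_iff_exp_le (by positivity)]
    linarith [Real.exp_one_lt_d9]
  have hs : √(N : ℝ) ≤ 1 + 6 * √(2 * N * Real.log (6 * N) + 4 * B * √N) := by
    have h1 : √(N : ℝ) ≤ √(2 * N * Real.log (6 * N) + 4 * B * √N) := by
      refine Real.sqrt_le_sqrt ?_
      have : 0 ≤ 4 * B * √(N : ℝ) := by positivity
      nlinarith
    linarith [Real.sqrt_nonneg (N : ℝ)]
  have hsN : 1 ≤ √(N : ℝ) := Real.one_le_sqrt.2 hN1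
  have e1 : Real.logb 2 N / 2 = Real.logb 2 √(N : ℝ) := by
    rw [Real.logb, Real.logb, Real.log_sqrt (by positivity)]; ring
  have e2 : Real.logb 2 √(N : ℝ) ≤
      Real.logb 2 (1 + 6 * √(2 * N * Real.log (6 * N) + 4 * B * √N)) :=
    Real.logb_le_logb_of_le h2 (by positivity) hs
  have e0 : 0 ≤ Real.logb 2 √(N : ℝ) := Real.logb_nonneg h2 hsN
  have e3 : 0 < Real.logb 2 (5 / 4 * N) := Real.logb_pos h2 (by linarith)
  have e4 : 0 ≤ B * Real.logb 2 (Real.exp 1) / 2 * √(N : ℝ) := by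
    have : 0 ≤ Real.logb 2 (Real.exp 1) := Real.logb_nonneg h2 (Real.one_le_exp zero_le_one)
    positivity
  have e5 : (N : ℝ) * Real.logb 2 N / 4 ≤ (d : ℝ) / 2 * N *
      Real.logb 2 (1 + 6 * √(2 * N * Real.log (6 * N) + 4 * B * √N)) := by
    calc (N : ℝ) * Real.logb 2 N / 4 = 1 / 2 * N * (Real.logb 2 N / 2) := by ring
      _ ≤ (d : ℝ) / 2 * N * Real.logb 2 (1 + 6 * √(2 * N * Real.log (6 * N) + 4 * B * √N)) := by
        rw [e1]; gcongr
  have e6 : 0 ≤ (N : ℝ) * Real.logb 2 N / 4 := by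
    have := Real.logb_nonneg h2 hN1
    positivity
  constructor
  · rw [netHeight, Nat.one_le_ceil_iff]
    linarith
  · refine le_trans ?_ (Nat.le_ceil _)
    linarith

lemma eLpNorm_sub_le_of_le_gaussWeight {d : ℕ} {a δ : ℝ} (ha : 0 < a) (hδ : 0 ≤ δ)
    {f g : (Fin d → ℝ) → ℝ} (h : ∀ x, |f x - g x| ≤ δ * gaussWeight a x) :
    eLpNorm (fun x => f x - g x) 2 (stdGaussianPi d) ≤
      ENNReal.ofReal (δ * (eLpNorm (gaussWeight a) 2 (stdGaussianPi d)).toReal) := by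
  calc _ ≤ eLpNorm (δ • gaussWeight a) 2 (stdGaussianPi d) := eLpNorm_mono_real h
    _ = _ := by
      rw [eLpNorm_const_smul, ENNReal.ofReal_mul hδ,
        ENNReal.ofReal_toReal (memLp_gaussWeight ha).eLpNorm_ne_top, Real.enorm_eq_ofReal hδ]

lemma ReLU3D.zero_mem_networks {d W K H : ℕ} (hW : 2 ≤ W) (hK : 1 ≤ K) (hH : 1 ≤ H) :
    (fun _ => 0) ∈ networks d W K H := by
  simpa using sum_mem_networks (d := d) (B := 0) (D := 1) hW hK hH (by simp) (ι := Fin 0) (by simp)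
    (fun i => i.elim0) (fun i => i.elim0) 0 0 one_pos one_pos (fun i => i.elim0)

theorem theorem3 (d : ℕ) (hd : 1 ≤ d) (τ : Fin d → ℝ) (hτ : ∀ j, 0 < τ j)
    (A : (Fin d → ℝ) → ℝ)
    (hA : ∀ β : Fin d → ℝ, (∀ j, 0 ≤ β j ∧ β j < τ j) → 0 < A β)
    (β : Fin d → ℝ) (hβ : ∀ j, 0 < β j ∧ β j < τ j) :
    ∃ C : ℝ, 0 < C ∧
      ∀ (f : (Fin d → ℝ) → ℝ) (F : (Fin d → ℂ) → ℂ),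
        IsHolomorphicContinuation τ f F →
        (∀ β' : Fin d → ℝ, (∀ j, 0 ≤ β' j ∧ β' j < τ j) → GrowthBound τ β' (A β') F) →
        ∀ N : ℕ, 1 ≤ N →
          ∃ Φ ∈ ReLU3D.networks d (max (8 * N * d) (N ^ d * (4 + d))) (N + d - 1)
              (netHeight d N (rateExponent β)),
            eLpNorm (fun x => f x - Φ x) 2 (stdGaussianPi d)
              ≤ ENNReal.ofReal (C * Real.exp (-rateExponent β * √(N : ℝ))) := by
  have hβ' : ∀ j, 0 ≤ β j ∧ β j < τ j := fun j => ⟨(hβ j).1.le, (hβ j).2⟩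
  have hAβ := hA β hβ'
  have : Nonempty (Fin d) := ⟨⟨0, hd⟩⟩
  obtain ⟨j₀, hj₀⟩ := Finite.exists_min β
  set b := β j₀
  have hb : 0 < b := (hβ j₀).1
  have hbτ : ∀ j, b < τ j := fun j => (hj₀ j).trans_lt (hβ j).2
  have h2 : (0 : ℝ) < √2 := by positivity
  set a := b / (2 * √2) with ha_def
  have ha : 0 < a := by positivity
  set B := rateExponent β with hB_def
  have hB : 0 < B := by
    have : 0 < ∏ j, β j := Finset.prod_pos fun j _ => (hβ j).1
    rw [hB_def, rateExponent]
    positivity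
  obtain ⟨C₁, C₂, hC₁, hC₂, C, hC, hCq⟩ := exists_parameters d
    (s := a * (b / 2)) (γ := d * (2 * b ^ 2 + a * b)) (B := B) (by positivity)
    (by have : (0 : ℝ) < d := by exact_mod_cast hd
        positivity) hB
  set L := (eLpNorm (gaussWeight (d := d) a) 2 (stdGaussianPi d)).toReal
  have hL : 0 ≤ L := ENNReal.toReal_nonneg
  -- the construction needs `Bt` batches of parallel programs and at most `C₃ * N` floors
  set Bt := (12 * C₁ * C₂) ^ d with hBt
  set C₃ := Bt * (28 * d * C₂ ^ 2 + 8) with hC₃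
  set N₀ := 2 ^ (4 * C₃) with hN₀
  refine ⟨A β * L * (C + Real.exp (B * √(N₀ : ℝ))) + 1, by positivity, ?_⟩
  intro f F hF hG N hN
  have hGβ := hG β hβ'
  have hN1 : (1 : ℝ) ≤ N := by exact_mod_cast hN
  have hFA : ∀ z : Fin d → ℂ, (∀ j, |(z j).im| ≤ b) →
      ‖F z‖ ≤ A β * Real.exp (∑ j, (z j).re ^ 2 / 4) := by
    intro z hz
    refine (hGβ z (fun j => (hz j).trans_lt (hbτ j)) fun j => ?_).trans ?_
    · have h1 : (z j).im ^ 2 ≤ β j ^ 2 := by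
        rw [← sq_abs]
        have := (hz j).trans (hj₀ j)
        gcongr
      nlinarith [sq_nonneg (z j).im]
    · refine mul_le_mul_of_nonneg_left (Real.exp_le_exp.2 ?_) hAβ.le
      refine Finset.sum_le_sum fun j _ => sub_le_self _ (by positivity)
  have hfA : ∀ x, |f x| ≤ A β * gaussWeight (2 * a) x := by
    intro x
    have h1 := hGβ (fun j => (x j : ℂ)) (fun j => by simpa using hτ j)
      fun j => by simpa using sq_nonneg (β j)
    rw [hF.2 x, Complex.norm_real, Real.norm_eq_abs] at h1
    refine h1.trans (mul_le_mul_of_nonneg_left (Real.exp_le_exp.2 ?_) hAβ.le)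
    refine Finset.sum_le_sum fun j _ => ?_
    simp only [Complex.ofReal_re, Complex.ofReal_im]
    rw [show β j ^ 2 - (0 : ℝ) ^ 2 / 2 = β j ^ 2 by ring, Real.sqrt_sq (hβ j).1.le]
    have e : 2 * a * |x j| = 1 / √2 * |x j| * b := by rw [ha_def]; field_simp
    rw [e]
    have := hj₀ j
    gcongr
  have hW : 2 ≤ max (8 * N * d) (N ^ d * (4 + d)) := le_max_of_le_left (by nlinarith)
  have hK : 1 ≤ N + d - 1 := by omega
  obtain ⟨hH, hHN⟩ := le_netHeight hd hN hB.le
  rcases lt_or_ge N N₀ with hlt | hge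
  · -- for the finitely many small `N` the zero function is good enough
    refine ⟨fun _ => 0, ReLU3D.zero_mem_networks hW hK hH, ?_⟩
    have hb0 : ∀ x, |f x - 0| ≤ A β * gaussWeight a x := by
      intro x
      rw [sub_zero]
      refine (hfA x).trans (mul_le_mul_of_nonneg_left (Real.exp_le_exp.2 ?_) hAβ.le)
      refine Finset.sum_le_sum fun j _ => ?_
      nlinarith [abs_nonneg (x j)]
    refine (eLpNorm_sub_le_of_le_gaussWeight ha hAβ.le hb0).trans (ENNReal.ofReal_le_ofReal ?_)
    have h1 : 1 ≤ Real.exp (B * √(N₀ : ℝ)) * Real.exp (-B * √(N : ℝ)) := by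
      rw [← Real.exp_add]
      refine Real.one_le_exp ?_
      have : √(N : ℝ) ≤ √(N₀ : ℝ) := Real.sqrt_le_sqrt (by exact_mod_cast hlt.le)
      nlinarith
    have h0 : 0 ≤ A β * L := by positivity
    calc A β * L ≤ A β * L * (Real.exp (B * √(N₀ : ℝ)) * Real.exp (-B * √(N : ℝ))) :=
          le_mul_of_one_le_right h0 h1
      _ ≤ A β * L * (Real.exp (B * √(N₀ : ℝ)) * Real.exp (-B * √(N : ℝ))) +
          (A β * L * C * Real.exp (-B * √(N : ℝ)) + Real.exp (-B * √(N : ℝ))) :=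
          le_add_of_nonneg_right (by positivity)
      _ = _ := by ring
  · -- both the number of cells per coordinate and the degree are proportional to `q`
    set q := ⌈√(N : ℝ)⌉₊
    have hsN : 1 ≤ √(N : ℝ) := Real.one_le_sqrt.2 hN1
    have hq0 : 0 < q := Nat.ceil_pos.2 (by linarith)
    have hqN : q ^ 2 ≤ 4 * N := by
      have h1 : (q : ℝ) ≤ 2 * √(N : ℝ) := by
        linarith [Nat.ceil_lt_add_one (Real.sqrt_nonneg (N : ℝ))]
      have h3 : (q : ℝ) ^ 2 ≤ 4 * N := by
        calc (q : ℝ) ^ 2 ≤ (2 * √(N : ℝ)) ^ 2 := by gcongr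
          _ = (4 * N : ℝ) := by rw [mul_pow, Real.sq_sqrt (by positivity)]; norm_num
      exact_mod_cast h3
    have hlen : Bt * (d * (C₂ * q) * (2 * (C₂ * q) + 5) + 2) ≤ C₃ * N := by
      have h5 : 5 ≤ 5 * (C₂ * q) := Nat.le_mul_of_pos_right _ (by positivity)
      have h6 : 2 ≤ 2 * q ^ 2 := Nat.le_mul_of_pos_right _ (by positivity)
      calc Bt * (d * (C₂ * q) * (2 * (C₂ * q) + 5) + 2)
          ≤ Bt * (d * (C₂ * q) * (2 * (C₂ * q) + 5 * (C₂ * q)) + 2 * q ^ 2) := by gcongr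
        _ = Bt * (7 * d * C₂ ^ 2 + 2) * q ^ 2 := by ring
        _ ≤ Bt * (7 * d * C₂ ^ 2 + 2) * (4 * N) := by gcongr
        _ = C₃ * N := by rw [hC₃]; ring
    have hC₃H : C₃ * N ≤ netHeight d N B := by
      have h1 : (4 * C₃ : ℝ) ≤ Real.logb 2 N := by
        rw [Real.le_logb_iff_rpow_le (by norm_num) (by positivity)]
        have h3 : ((2 : ℝ)) ^ (4 * C₃ : ℝ) = (N₀ : ℝ) := by
          rw [hN₀, show (4 * C₃ : ℝ) = ((4 * C₃ : ℕ) : ℝ) by push_cast; ring, Real.rpow_natCast]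
          push_cast
          rfl
        rw [h3]
        exact_mod_cast hge
      have h3 : (C₃ * N : ℝ) ≤ netHeight d N B := by
        refine le_trans ?_ hHN
        nlinarith
      exact_mod_cast h3
    have hcount : ((2 * (C₁ * q) + 1) * (C₂ * q)) ^ d ≤
        Bt * max (8 * N * d) (N ^ d * (4 + d)) := by
      have h1 : 1 ≤ C₁ * q := Nat.mul_pos hC₁ hq0
      calc ((2 * (C₁ * q) + 1) * (C₂ * q)) ^ d
          ≤ ((2 * (C₁ * q) + C₁ * q) * (C₂ * q)) ^ d := by gcongr
        _ = (3 * C₁ * C₂ * q ^ 2) ^ d := by ring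
        _ ≤ (3 * C₁ * C₂ * (4 * N)) ^ d := by gcongr
        _ = Bt * N ^ d := by rw [hBt, ← mul_pow]; ring
        _ ≤ Bt * max (8 * N * d) (N ^ d * (4 + d)) := by
          gcongr
          exact le_max_of_le_right (Nat.le_mul_of_pos_right _ (by omega))
    obtain ⟨Φ, hΦ, hE⟩ := ReLU3D.exists_network_approx ha hb hAβ hbτ hF hFA hfA
      (P := C₁ * q) (n := C₂ * q) (Nat.mul_pos hC₂ hq0) hW hK hH (hlen.trans hC₃H) hcount
    refine ⟨Φ, hΦ, ?_⟩
    have hδ : ∀ x, |f x - Φ x| ≤ A β * (C * Real.exp (-B * √(N : ℝ))) * gaussWeight a x := by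
      intro x
      refine (hE x).trans ?_
      have h1 := hCq q hq0
      have h3 : Real.exp (-(B * q)) ≤ Real.exp (-B * √(N : ℝ)) := by
        rw [Real.exp_le_exp]
        nlinarith [Nat.le_ceil √(N : ℝ)]
      have h4 : 0 ≤ gaussWeight a x := (Real.exp_pos _).le
      refine mul_le_mul_of_nonneg_right (mul_le_mul_of_nonneg_left ?_ hAβ.le) h4
      rw [← mul_assoc a]
      exact h1.trans (mul_le_mul_of_nonneg_left h3 hC.le)
    refine (eLpNorm_sub_le_of_le_gaussWeight ha (by positivity) hδ).trans
      (ENNReal.ofReal_le_ofReal ?_)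
    calc A β * (C * Real.exp (-B * √(N : ℝ))) * L
        ≤ A β * (C * Real.exp (-B * √(N : ℝ))) * L +
          (A β * L * Real.exp (B * √(N₀ : ℝ)) * Real.exp (-B * √(N : ℝ)) +
            Real.exp (-B * √(N : ℝ))) := le_add_of_nonneg_right (by positivity)
      _ = _ := by ring
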